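/- **Model.** Let $X_t=f_t+\varepsilon_t$, $t=1,\dots,T$, where $\varepsilon_1,\dots,\varepsilon_T$ are i.i.d. $N(0,\sigma^2)$, $\sigma>0$, and $f$ is deterministic and piecewise constant with exactly $N\ge 0$ change-points $\eta_1<\dots<\eta_N$ ($\eta_i$ is the first time of a new segment; $\eta_0=1$, $\eta_{N+1}=T+1$). Assume $\eta_i-\eta_{i-1}\ge\delta T$ for $i=1,\dots,N+1$, with $\delta>0$; $|f_t|\le\bar f<\infty$; and $|f_{\eta_i}-f_{\eta_i-1}|\ge \underline f_T\ge C\,T^{\kappa}$ for $i=1,\dots,N$, with $C>0$, $\kappa>-1/2$. **WBS2 path.** For $s\le b<e$, $n=e-s+1$, let $$\tilde X_{s,e}^b=\sqrt{\tfrac{e-b}{n(b-s+1)}}\sum_{t=s}^bX_t-\sqrt{\tfrac{b-s+1}{n(e-b)}}\sum_{t=b+1}^eX_t .$$ Let $\tilde M\ge1$. On a domain $[s,e]$ with $s<e$ (start with $[1,T]$), take all intervals $[s_m,e_m]\subseteq[s,e]$ with $s_m<e_m$ if there are at most $\tilde M$ of them, and otherwise $\tilde M$ such intervals, drawn independently and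 uniformly, independently of the data and of the draws on other domains. Let $(s_{m_0},e_{m_0},b_{m_0})$ maximise $|\tilde X_{s_m,e_m}^b|$ over $m$ and $s_m\le b<e_m$; record it, and repeat on $[s,b_{m_0}]$ and on $[b_{m_0}+1,e]$. Domains of length 1 are left alone. The path $\tilde{\mathcal P}=(s_k,e_k,b_k)_{k=1}^{T-1}$ is the sequence of recorded triples, sorted so that $a_k=|\tilde X_{s_k,e_k}^{b_k}|$ is non-increasing, with ties broken in any way. **SDLL.** Given a random variable $\hat\sigma_T$ (the estimate of $\sigma$), $\beta\in(0,1)$ and a constant $\tilde C$, let $\tilde\zeta_T=\tilde C\hat\sigma_T(2\log T)^{1/2}$. If $a_1<\tilde\zeta_T$, put $\hat N=0$. Otherwise let $K=\max\{k\ge0: a_{k+1}\ge\beta\tilde\zeta_T\}$. If $K=0$, put $\hat N=1$. If $K\ge1$, let $\hat N$ be a maximiser of $\log a_k-\log a_{k+1}$ over those $k\in\{1,\dots,K\}$ with $a_{k+1}\le\tilde\zeta_T$, and $\hat N=K+1$ if there is no such $k$. Let $\tilde\eta_1\le\dots\le\tilde\eta_{\hat N}$ be $b_1,\dots,b_{\hat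 N}$ in increasing order. **Theorem.** Fix $\sigma,\delta>0$. For every $\Delta>0$ there is a constant $C_1(\Delta)>0$, depending only on $\Delta$ (and on the fixed $\sigma$ and $\delta$), such that the following holds for every $\theta>0$, all large enough constants $\tilde C$, and all fixed $\beta\in(0,1)$, $\bar f$, $C>0$, $\kappa>-1/2$. For all $T$ large enough, uniformly over $f$, $N$, $\eta_i$, $\underline f_T$ as above and over $\tilde M\ge1$, $$P\Big(\hat N=N\ \text{ and }\ \max_{i\le \hat N}|\eta_i-\tilde\eta_i|\le C_1(\Delta)\underline f_T^{-2}\log T\Big)\ \ge\ 1-\alpha_T-\tfrac12N(N+1)\big(2C_1(\Delta)\underline f_T^{-2}\log T+1\big)^2\big(1-\tfrac{\delta^2}{9}\big)^{\tilde M}-P\Big(\tfrac{\hat\sigma_T}{\sigma}\notin\big((1+\theta)^{-1},1+\theta\big)\Big),$$ where $$\alpha_T=1-P\Big(\forall\,1\le l\le m\le T:\ (m-l+1)^{-1/2}\Big|\sum_{i=l}^m\varepsilon_i\Big|\le\sigma\{2(1+\Delta)\log T\}^{1/2}\Big).$$ -/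

import Mathlib

open MeasureTheory ProbabilityTheory

namespace WBS2

/-- The CUSUM statistic of the data portion `X s, …, X e` at `b`, for `s ≤ b < e`. -/
noncomputable def cusum (X : ℕ → ℝ) (s e b : ℕ) : ℝ :=
  √(((e : ℝ) - b) / (((e : ℝ) - s + 1) * ((b : ℝ) - s + 1))) * ∑ t ∈ Finset.Icc s b, X t
    - √(((b : ℝ) - s + 1) / (((e : ℝ) - s + 1) * ((e : ℝ) - b))) *
      ∑ t ∈ Finset.Icc (b + 1) e, X t

/-- A change-point candidate `(s, e, b)`: the split `b` of the interval `[s, e]`. -/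
structure Candidate where
  /-- start of the interval -/
  left : ℕ
  /-- end of the interval -/
  right : ℕ
  /-- location of the split -/
  split : ℕ

/-- The absolute CUSUM of a candidate (the fourth component of an entry of the solution path). -/
noncomputable def Candidate.mag (X : ℕ → ℝ) (c : Candidate) : ℝ :=
  |cusum X c.left c.right c.split|

/-- All intervals `[u, v] ⊆ [s, e]` with `u < v`, as pairs `(u, v)`. There are
`(e - s + 1) (e - s) / 2` of them. -/
def subintervals (s e : ℕ) : Finset (ℕ × ℕ) :=
  (Finset.Icc s e ×ˢ Finset.Icc s e).filter fun p => p.1 < p.2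

/-- The intervals examined on the domain `[s, e]`: all subintervals if there are at most `M` of
them, and otherwise the `M` random ones `D s e 0, …, D s e (M - 1)`. (Draws always are
subintervals of the domain; the intersection only makes the definition total.) -/
def examined (D : ℕ → ℕ → ℕ → ℕ × ℕ) (M s e : ℕ) : Finset (ℕ × ℕ) :=
  if (e - s + 1) * (e - s) ≤ 2 * M then subintervals s e
  else (Finset.range M).image (D s e) ∩ subintervals s e

/-- `c` is an arg-max of the absolute CUSUM over the intervals in `I` and all splits of these. -/
def IsBest (X : ℕ → ℝ) (I : Finset (ℕ × ℕ)) (c : Candidate) : Prop :=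
  ((c.left, c.right) ∈ I ∧ c.left ≤ c.split ∧ c.split < c.right) ∧
    ∀ p ∈ I, ∀ b, p.1 ≤ b → b < p.2 → |cusum X p.1 p.2 b| ≤ c.mag X

theorem IsBest.bounds {X : ℕ → ℝ} {D : ℕ → ℕ → ℕ → ℕ × ℕ} {M s e : ℕ} {c : Candidate}
    (h : IsBest X (examined D M s e) c) : s ≤ c.split ∧ c.split < e := by
  obtain ⟨⟨hI, h1, h2⟩, -⟩ := h
  have hs : (c.left, c.right) ∈ subintervals s e := by
    unfold examined at hI
    split_ifs at hI
    · exact hI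
    · exact (Finset.mem_inter.1 hI).2
  simp only [subintervals, Finset.mem_filter, Finset.mem_product, Finset.mem_Icc] at hs
  omega

open Classical in
/-- The (unsorted) output of the recursive solution path routine on the domain `[s, e]`: the best
candidate, followed by the output on the part up to its split and on the part after its split.
It is empty if `e ≤ s`. Ties in the arg-max are resolved by a rule which depends on the set of
maximisers only. -/
noncomputable def solPath (X : ℕ → ℝ) (D : ℕ → ℕ → ℕ → ℕ × ℕ) (M : ℕ) (s e : ℕ) :
    List Candidate :=
  if h : ∃ c, IsBest X (examined D M s e) c then
    h.choose :: (solPath X D M s h.choose.split ++ solPath X D M (h.choose.split + 1) e)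
  else []
termination_by e - s
decreasing_by
  · have := h.choose_spec.bounds
    omega
  · have := h.choose_spec.bounds
    omega

/-- `P` is a rearrangement of the list `Q` of candidates with non-increasing absolute CUSUMs
(ties may be broken in any way). -/
def IsSorted (X : ℕ → ℝ) (Q P : List Candidate) : Prop :=
  P.Perm Q ∧ (P.map (Candidate.mag X)).Pairwise (· ≥ ·)

/-- The absolute CUSUM of the `k`-th entry of the path `P`, for `k = 1, …, P.length`. -/
noncomputable def pathMag (X : ℕ → ℝ) (P : List Candidate) (k : ℕ) : ℝ :=
  (P.map (Candidate.mag X)).getD (k - 1) 0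

open Classical in
/-- The model size selected by SDLL from a path of length `n` with sorted absolute CUSUMs
`a 1 ≥ … ≥ a n`, with threshold `ζ` and parameter `β`. Here `K` is the largest `k` with
`a (k + 1) ≥ β ζ`, and the drop `log (a k) - log (a (k + 1))` is maximised
over those `k = 1, …, K` for which `a (k + 1) ≤ ζ`. -/
noncomputable def sdllSize (a : ℕ → ℝ) (n : ℕ) (ζ β : ℝ) : ℕ :=
  if n = 0 then 0
  else if a 1 < ζ then 0
  else
    let K := Nat.findGreatest (fun k => β * ζ ≤ a (k + 1)) (n - 1)
    if K = 0 then 1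
    else
      let F := (Finset.Icc 1 K).filter fun k => a (k + 1) ≤ ζ
      if h : F.Nonempty then
        (F.exists_max_image (fun k => Real.log (a k) - Real.log (a (k + 1))) h).choose
      else K + 1

/-- The estimated number of change-points. -/
noncomputable def sdllN (X : ℕ → ℝ) (P : List Candidate) (ζ β : ℝ) : ℕ :=
  sdllSize (pathMag X P) P.length ζ β

/-- The `i`-th estimated change-point, `i = 1, 2, …`: the splits of the first `sdllN` entries of
the path, in increasing order. -/
noncomputable def sdllLoc (X : ℕ → ℝ) (P : List Candidate) (ζ β : ℝ) (i : ℕ) : ℕ :=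
  (((P.take (sdllN X P ζ β)).map Candidate.split).insertionSort (· ≤ ·)).getD (i - 1) 0

/-- On `{1, …, T}` the signal `f` is piecewise constant with exactly the `N` change-points
`η 1 < … < η N`; by convention `η 0 = 1` and `η (N + 1) = T + 1`. A change-point is the first
time of a new segment. -/
structure IsChangePoints (f : ℕ → ℝ) (T N : ℕ) (η : ℕ → ℕ) : Prop where
  zero : η 0 = 1
  last : η (N + 1) = T + 1
  lt : ∀ i ≤ N, η i < η (i + 1)
  const : ∀ i ≤ N, ∀ t, η i ≤ t → t < η (i + 1) → f t = f (η i)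
  jump : ∀ i, 1 ≤ i → i ≤ N → f (η i) ≠ f (η i - 1)

/-- The conditions on a signal of length `T` with change-points `η 1, …, η N`: spacings at least
`δ T`, values bounded by `fbar`, and jumps of size at least `fmin`, where `fmin ≥ C T ^ κ`. -/
structure SignalConditions (δ fbar C κ : ℝ) (f : ℕ → ℝ) (T N : ℕ) (η : ℕ → ℕ) (fmin : ℝ) :
    Prop where
  changePoints : IsChangePoints f T N η
  spacing : ∀ i, 1 ≤ i → i ≤ N + 1 → δ * T ≤ (η i : ℝ) - η (i - 1)
  bounded : ∀ t, 1 ≤ t → t ≤ T → |f t| ≤ fbar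
  jump_ge : ∀ i, 1 ≤ i → i ≤ N → fmin ≤ |f (η i) - f (η i - 1)|
  fmin_ge : C * (T : ℝ) ^ κ ≤ fmin

section Probability

variable {Ω : Type*} [MeasurableSpace Ω]

/-- `ε 1, …, ε T` are i.i.d. `N(0, σ²)`. -/
structure IsGaussianNoise (μ : Measure Ω) (σ : ℝ) (T : ℕ) (ε : ℕ → Ω → ℝ) : Prop where
  measurable : ∀ t, Measurable (ε t)
  law : ∀ t, 1 ≤ t → t ≤ T → μ.map (ε t) = gaussianReal 0 (σ ^ 2).toNNReal
  indep : iIndepFun ε μ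

/-- The random intervals of the procedure on `{1, …, T}`: for every domain
`[s, e] ⊆ [1, T]` with `s < e`, the intervals `D s e 0, …, D s e (M - 1)` are uniformly distributed
on the subintervals of `[s, e]`, and all of these draws are independent. Since the
recursion visits each domain at most once, drawing the intervals of a domain in
advance is the same as drawing them afresh when the recursion reaches the domain. -/
structure IsIntervalDraw (μ : Measure Ω) (T M : ℕ) (D : ℕ → ℕ → ℕ → Ω → ℕ × ℕ) : Prop where
  measurable : ∀ s e m, Measurable (D s e m)
  mem : ∀ s e m, 1 ≤ s → s < e → e ≤ T → m < M → ∀ ω, D s e m ω ∈ subintervals s e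
  uniform : ∀ s e m, 1 ≤ s → s < e → e ≤ T → m < M → ∀ p ∈ subintervals s e,
    μ.real {ω | D s e m ω = p} = 1 / ((subintervals s e).card : ℝ)
  indep : iIndepFun (fun i : ℕ × ℕ × ℕ => D i.1 i.2.1 i.2.2) μ

/-- The event that all normalised partial sums of the noise are at most
`σ (2 (1 + Δ) log T) ^ (1/2)` in absolute value. -/
def noiseEvent (σ Δ : ℝ) (T : ℕ) (ε : ℕ → Ω → ℝ) : Set Ω :=
  {ω | ∀ l m, 1 ≤ l → l ≤ m → m ≤ T →
    |∑ i ∈ Finset.Icc l m, ε i ω| / √((m : ℝ) - l + 1) ≤ σ * √(2 * (1 + Δ) * Real.log T)}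

/-- `α_T`, the probability that the noise event fails. -/
noncomputable def alpha (μ : Measure Ω) (σ Δ : ℝ) (T : ℕ) (ε : ℕ → Ω → ℝ) : ℝ :=
  1 - μ.real (noiseEvent σ Δ T ε)

end Probability

end WBS2

/-! Outside three exceptional events (a noise sum above the level `lam`, a bad estimate of σ, random
intervals that miss) the argument is deterministic; `Regime` collects what it needs. Let `W` be a
constant times log T, and call b near a change-point if its distance times the squared jump is at
most `W`.

Take a domain whose ends are near η i and η j. If no change-point lies between, the leftover signal
at the two ends has sum of squares of order `W`, so by Cauchy–Schwarz every CUSUM is of noise order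
√(log T). Otherwise an examined interval isolates a largest intermediate jump J and has a CUSUM of
order J√T, so the selected split b has a CUSUM G at least that large. As the other jumps are at most
J, b is at distance of order T from the ends of its interval (`Regime.split_far`).

Localisation (`mul_le_of_cusum_max_of_pos`): on a stretch around b where the signal is constant, the
signal part of the centred sum is affine, while G times `scale` majorises the centred sum and
touches it at b (for a positive CUSUM). Since `scale` is strongly concave, noise must pay for the
gap, and the distance to the nearer end of the stretch times J² is at most a constant times lam².
That constant does not involve the errors of the domain's own ends, so `W` does not grow along the
recursion: b is near some intermediate change-point, and induction continues on both parts
(`Regime.exists_solPath_perm`).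

Hence the path has N candidates of magnitude at least of order fmin √T, one near each change-point,
and all others are of order √(log T). As κ > -1/2 separates these scales, the threshold fits between
them and the largest admissible log-drop is at N (`sdllSize_eq`). The chance of missing intervals is
bounded by a union over deterministic domains, so the dependence of the visited domains on the data
does no harm. -/

namespace WBS2

/-! ### Noise-type bounds on sums over subintervals. -/

/-- Partial sums of the sums `h l + ⋯ + h m` over subintervals of `[lo, hi]` grow at most like
`Λ` times the square root of the length. -/
def SumBound (h : ℕ → ℝ) (lo hi : ℕ) (Λ : ℝ) : Prop :=
  ∀ l m, lo ≤ l → l ≤ m → m ≤ hi → |∑ t ∈ Finset.Icc l m, h t| ≤ Λ * √((m : ℝ) - l + 1)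

theorem SumBound.mono {h : ℕ → ℝ} {lo hi lo' hi' : ℕ} {Λ : ℝ} (H : SumBound h lo hi Λ)
    (hlo : lo ≤ lo') (hhi : hi' ≤ hi) : SumBound h lo' hi' Λ :=
  fun l m h1 h2 h3 => H l m (hlo.trans h1) h2 (h3.trans hhi)

theorem SumBound.neg {h : ℕ → ℝ} {lo hi : ℕ} {Λ : ℝ} (H : SumBound h lo hi Λ) :
    SumBound (fun t => -h t) lo hi Λ := by
  intro l m h1 h2 h3
  rw [Finset.sum_neg_distrib, abs_neg]
  exact H l m h1 h2 h3

theorem SumBound.add {g h : ℕ → ℝ} {lo hi : ℕ} {Λ Λ' : ℝ} (G : SumBound g lo hi Λ)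
    (H : SumBound h lo hi Λ') : SumBound (fun t => g t + h t) lo hi (Λ + Λ') := by
  intro l m h1 h2 h3
  rw [Finset.sum_add_distrib, add_mul]
  exact (abs_add_le _ _).trans (add_le_add (G l m h1 h2 h3) (H l m h1 h2 h3))

/-- By Cauchy–Schwarz, a sequence with small sum of squares has small sums. -/
theorem sumBound_of_sum_sq_le {h : ℕ → ℝ} {lo hi : ℕ} {V : ℝ}
    (H : ∑ t ∈ Finset.Icc lo hi, h t ^ 2 ≤ V) : SumBound h lo hi √V := by
  intro l m h1 h2 h3
  have hcard : ((Finset.Icc l m).card : ℝ) = (m : ℝ) - l + 1 := by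
    rw [Nat.card_Icc, Nat.cast_sub (by omega)]
    push_cast
    ring
  have h0 : (0 : ℝ) ≤ (m : ℝ) - l + 1 := by
    rw [← hcard]
    positivity
  have h4 := sq_sum_le_card_mul_sum_sq (s := Finset.Icc l m) (f := h)
  have h5 : ∑ t ∈ Finset.Icc l m, h t ^ 2 ≤ V :=
    (Finset.sum_le_sum_of_subset_of_nonneg (Finset.Icc_subset_Icc h1 h3)
      fun _ _ _ => sq_nonneg _).trans H
  have hV : 0 ≤ V := (Finset.sum_nonneg fun _ _ => sq_nonneg _).trans h5
  rw [← Real.sqrt_mul hV]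
  apply Real.abs_le_sqrt
  rw [hcard] at h4
  nlinarith

/-- `x 0 + ⋯ + x b`. -/
def psum (x : ℕ → ℝ) (b : ℕ) : ℝ := ∑ t ∈ Finset.range (b + 1), x t

theorem sum_Icc_eq_psum_sub (x : ℕ → ℝ) {a b : ℕ} (h : a ≤ b) :
    ∑ t ∈ Finset.Icc (a + 1) b, x t = psum x b - psum x a := by
  unfold psum
  rw [← Finset.sum_Ico_eq_sub x (by omega : a + 1 ≤ b + 1)]
  rfl

theorem SumBound.psum {h : ℕ → ℝ} {lo hi : ℕ} {Λ : ℝ} (H : SumBound h lo hi Λ) {a b : ℕ}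
    (h1 : lo ≤ a + 1) (h2 : a ≤ b) (h3 : b ≤ hi) :
    |psum h b - psum h a| ≤ Λ * √((b : ℝ) - a) := by
  rcases h2.eq_or_lt with rfl | h2
  · simp
  · have := H (a + 1) b h1 h2 h3
    rw [sum_Icc_eq_psum_sub h h2.le] at this
    convert this using 3
    push_cast
    ring

theorem psum_add (g h : ℕ → ℝ) (b : ℕ) : psum (fun t => g t + h t) b = psum g b + psum h b := by
  simp [psum, Finset.sum_add_distrib]

theorem psum_sub_of_const {x : ℕ → ℝ} {a b : ℕ} {c : ℝ} (hab : a ≤ b)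
    (h : ∀ t, a < t → t ≤ b → x t = c) : psum x b - psum x a = ((b : ℝ) - a) * c := by
  rw [← sum_Icc_eq_psum_sub x hab, Finset.sum_congr rfl (g := fun _ => c), Finset.sum_const,
    Nat.card_Icc, nsmul_eq_mul]
  · rw [show b + 1 - (a + 1) = b - a by omega, Nat.cast_sub hab]
  · intro t ht
    rw [Finset.mem_Icc] at ht
    exact h t (by omega) ht.2

/-! ### The CUSUM as a rescaled centred partial sum. -/

/-- The Euclidean norm of the unnormalised CUSUM contrast. -/
noncomputable def scale (a v b : ℝ) : ℝ := √((b - a) * (v - b) / (v - a))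

/-- The unnormalised CUSUM: the partial sum of the centred data on `(a, v]`. -/
noncomputable def centredSum (x : ℕ → ℝ) (a v b : ℕ) : ℝ :=
  psum x b - psum x a - ((b : ℝ) - a) / ((v : ℝ) - a) * (psum x v - psum x a)

theorem cusum_eq_psum (x : ℕ → ℝ) {a v b : ℕ} (h1 : a < b) (h2 : b < v) :
    cusum x (a + 1) v b =
      √(((v : ℝ) - b) / (((v : ℝ) - a) * ((b : ℝ) - a))) * (psum x b - psum x a)
      - √(((b : ℝ) - a) / (((v : ℝ) - a) * ((v : ℝ) - b))) * (psum x v - psum x b) := by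
  unfold cusum
  rw [sum_Icc_eq_psum_sub x h1.le, sum_Icc_eq_psum_sub x h2.le]
  push_cast
  rw [show (v : ℝ) - (a + 1) + 1 = v - a by ring, show (b : ℝ) - (a + 1) + 1 = b - a by ring]

theorem scale_pos {a v b : ℝ} (h1 : a < b) (h2 : b < v) : 0 < scale a v b := by
  unfold scale
  have := sub_pos.2 h1
  have := sub_pos.2 h2
  have := sub_pos.2 (h1.trans h2)
  positivity

theorem scale_nonneg (a v b : ℝ) : 0 ≤ scale a v b := Real.sqrt_nonneg _

theorem scale_sq {a v b : ℝ} (h1 : a ≤ b) (h2 : b ≤ v) :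
    scale a v b ^ 2 = (b - a) * (v - b) / (v - a) := by
  unfold scale
  have := sub_nonneg.2 h1
  have := sub_nonneg.2 h2
  have := sub_nonneg.2 (h1.trans h2)
  exact Real.sq_sqrt (by positivity)

/-- This clears the square roots of the CUSUM: as a function of `b`, the right side is a partial sum
minus a linear term. -/
theorem cusum_mul_scale (x : ℕ → ℝ) {a v b : ℕ} (h1 : a < b) (h2 : b < v) :
    cusum x (a + 1) v b * scale a v b = centredSum x a v b := by
  have h1' : (0 : ℝ) < (b : ℝ) - a := sub_pos.2 (by exact_mod_cast h1)
  have h2' : (0 : ℝ) < (v : ℝ) - b := sub_pos.2 (by exact_mod_cast h2)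
  have h3' : (0 : ℝ) < (v : ℝ) - a := by linarith
  have e1 : √(((v : ℝ) - b) / (((v : ℝ) - a) * ((b : ℝ) - a))) * scale a v b
      = ((v : ℝ) - b) / ((v : ℝ) - a) := by
    unfold scale
    rw [← Real.sqrt_mul (by positivity),
      ← Real.sqrt_sq (show 0 ≤ ((v : ℝ) - b) / ((v : ℝ) - a) by positivity)]
    congr 1
    field_simp
  have e2 : √(((b : ℝ) - a) / (((v : ℝ) - a) * ((v : ℝ) - b))) * scale a v b
      = ((b : ℝ) - a) / ((v : ℝ) - a) := by
    unfold scale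
    rw [← Real.sqrt_mul (by positivity),
      ← Real.sqrt_sq (show 0 ≤ ((b : ℝ) - a) / ((v : ℝ) - a) by positivity)]
    congr 1
    field_simp
  rw [cusum_eq_psum x h1 h2, sub_mul, mul_right_comm, e1, mul_right_comm, e2, centredSum]
  field_simp
  ring

theorem cusum_add (g h : ℕ → ℝ) (s e b : ℕ) :
    cusum (fun t => g t + h t) s e b = cusum g s e b + cusum h s e b := by
  simp only [cusum, Finset.sum_add_distrib]
  ring

theorem cusum_neg (h : ℕ → ℝ) (s e b : ℕ) :
    cusum (fun t => -h t) s e b = -cusum h s e b := by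
  simp only [cusum, Finset.sum_neg_distrib]
  ring

/-- Each half-sum is at most `Λ` times the root of its length, and its weight is at most the inverse
of that root. -/
theorem SumBound.abs_cusum_le {h : ℕ → ℝ} {a v b : ℕ} {Λ : ℝ} (hΛ : 0 ≤ Λ)
    (H : SumBound h (a + 1) v Λ) (h1 : a < b) (h2 : b < v) :
    |cusum h (a + 1) v b| ≤ 2 * Λ := by
  have h1' : (0 : ℝ) < (b : ℝ) - a := sub_pos.2 (by exact_mod_cast h1)
  have h2' : (0 : ℝ) < (v : ℝ) - b := sub_pos.2 (by exact_mod_cast h2)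
  have h3' : (0 : ℝ) < (v : ℝ) - a := by linarith
  have b1 := H.psum le_rfl h1.le h2.le
  have b2 := H.psum (by omega) h2.le le_rfl
  have key : ∀ y z w S : ℝ, 0 < y → 0 < z → z ≤ w → |S| ≤ Λ * √y → |√(z / (w * y)) * S| ≤ Λ := by
    intro y z w S hy hz hzw hS
    rw [abs_mul, abs_of_nonneg (Real.sqrt_nonneg _)]
    calc √(z / (w * y)) * |S| ≤ √(z / (w * y)) * (Λ * √y) := by gcongr
      _ = Λ * √(z / w) := by
        rw [mul_left_comm, ← Real.sqrt_mul (by have := hz.trans_le hzw; positivity)]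
        congr 2
        have := hz.trans_le hzw
        field_simp
      _ ≤ Λ * 1 := by
        gcongr
        rw [Real.sqrt_le_one, div_le_one (hz.trans_le hzw)]
        exact hzw
      _ = Λ := mul_one _
  rw [cusum_eq_psum h h1 h2]
  have c1 := key _ _ _ _ h1' h2' (by linarith : (v : ℝ) - b ≤ (v : ℝ) - a) b1
  have c2 := key _ _ _ _ h2' h1' (by linarith : (b : ℝ) - a ≤ (v : ℝ) - a) b2
  calc _ ≤ _ := abs_sub _ _
    _ ≤ 2 * Λ := by linarith

/-- The constant `c` cancels in the contrast, and after multiplication by `scale` each half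
contributes at most `r` times `scale` squared. -/
theorem abs_cusum_le_of_abs_sub_le {h : ℕ → ℝ} {a v b : ℕ} {c r : ℝ}
    (H : ∀ t, a < t → t ≤ v → |h t - c| ≤ r) (h1 : a < b) (h2 : b < v) :
    |cusum h (a + 1) v b| ≤ 2 * r * scale a v b := by
  have h1' : (0 : ℝ) < (b : ℝ) - a := sub_pos.2 (by exact_mod_cast h1)
  have h2' : (0 : ℝ) < (v : ℝ) - b := sub_pos.2 (by exact_mod_cast h2)
  have h3' : (0 : ℝ) < (v : ℝ) - a := by linarith
  have key : ∀ y z : ℕ, a ≤ y → y ≤ z → z ≤ v →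
      |psum h z - psum h y - ((z : ℝ) - y) * c| ≤ ((z : ℝ) - y) * r := by
    intro y z hy hyz hz
    have e : psum h z - psum h y - ((z : ℝ) - y) * c = ∑ t ∈ Finset.Icc (y + 1) z, (h t - c) := by
      rw [Finset.sum_sub_distrib, sum_Icc_eq_psum_sub h hyz, Finset.sum_const, Nat.card_Icc,
        nsmul_eq_mul, show z + 1 - (y + 1) = z - y by omega, Nat.cast_sub hyz]
    rw [e]
    refine (Finset.abs_sum_le_sum_abs _ _).trans
      ((Finset.sum_le_card_nsmul _ _ r fun t ht => ?_).trans_eq ?_)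
    · rw [Finset.mem_Icc] at ht
      exact H t (by omega) (by omega)
    · rw [Nat.card_Icc, nsmul_eq_mul, show z + 1 - (y + 1) = z - y by omega, Nat.cast_sub hyz]
  have k1 := key a b le_rfl h1.le h2.le
  have k2 := key b v h1.le h2.le le_rfl
  have hs := scale_pos (a := (a : ℝ)) (b := (b : ℝ)) (v := (v : ℝ)) (by linarith) (by linarith)
  rw [← mul_le_mul_iff_of_pos_right hs, ← abs_of_pos hs, ← abs_mul, abs_of_pos hs,
    cusum_mul_scale h h1 h2, mul_assoc, ← sq, scale_sq (by linarith) (by linarith)]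
  have e : centredSum h a v b
      = (v - b) / (v - a) * (psum h b - psum h a - ((b : ℝ) - a) * c)
        - (b - a) / (v - a) * (psum h v - psum h b - ((v : ℝ) - b) * c) := by
    unfold centredSum
    field_simp
    ring
  rw [e]
  refine (abs_sub _ _).trans ?_
  rw [abs_mul, abs_mul, abs_of_pos (by positivity : 0 < ((v : ℝ) - b) / (v - a)),
    abs_of_pos (by positivity : 0 < ((b : ℝ) - a) / (v - a))]
  calc _ ≤ (v - b) / (v - a) * (((b : ℝ) - a) * r) + (b - a) / (v - a) * (((v : ℝ) - b) * r) := by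
        gcongr
    _ = _ := by
      field_simp
      ring

theorem cusum_of_single_jump {h : ℕ → ℝ} {a v b : ℕ} {c d : ℝ} (h1 : a < b) (h2 : b < v)
    (hc : ∀ t, a < t → t ≤ b → h t = c) (hd : ∀ t, b < t → t ≤ v → h t = d) :
    cusum h (a + 1) v b = (c - d) * scale a v b := by
  have h1' : (0 : ℝ) < (b : ℝ) - a := sub_pos.2 (by exact_mod_cast h1)
  have h2' : (0 : ℝ) < (v : ℝ) - b := sub_pos.2 (by exact_mod_cast h2)
  have h3' : (0 : ℝ) < (v : ℝ) - a := by linarith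
  have k1 := psum_sub_of_const h1.le hc
  have k2 := psum_sub_of_const h2.le hd
  have hs := scale_pos (a := (a : ℝ)) (b := (b : ℝ)) (v := (v : ℝ)) (by linarith) (by linarith)
  apply mul_right_cancel₀ hs.ne'
  rw [cusum_mul_scale h h1 h2, mul_assoc, ← sq, scale_sq (by linarith) (by linarith), centredSum,
    show psum h v - psum h a = ((v : ℝ) - b) * d + ((b : ℝ) - a) * c by linarith, k1]
  field_simp
  ring

theorem scale_le_sqrt_left {a v b : ℝ} (h1 : a ≤ b) (h2 : b < v) : scale a v b ≤ √(b - a) := by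
  apply Real.sqrt_le_sqrt
  rw [div_le_iff₀ (by linarith)]
  exact mul_le_mul_of_nonneg_left (by linarith) (by linarith)

theorem scale_le_sqrt_right {a v b : ℝ} (h1 : a < b) (h2 : b ≤ v) : scale a v b ≤ √(v - b) := by
  apply Real.sqrt_le_sqrt
  rw [div_le_iff₀ (by linarith), mul_comm]
  exact mul_le_mul_of_nonneg_left (by linarith) (by linarith)

theorem sqrt_le_scale {a v b l : ℝ} (hl : 0 < l) (h1 : l ≤ b - a) (h2 : l ≤ v - b) :
    √(l / 2) ≤ scale a v b := by
  apply Real.sqrt_le_sqrt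
  rw [div_le_div_iff₀ (by linarith) (by linarith)]
  nlinarith [mul_nonneg (sub_nonneg.2 h1) (hl.le.trans h2),
    mul_nonneg (sub_nonneg.2 h2) (hl.le.trans h1)]

/-! ### Strong concavity and localisation of the arg-max. -/

/-- Strong concavity of `scale` in its last argument. -/
theorem scale_strongly_concave {a v p b q : ℝ} (hav : a < v) (hap : a ≤ p) (hpb : p ≤ b)
    (hbq : b ≤ q) (hqv : q ≤ v) (hpq : p < q) :
    (q - b) * scale a v p + (b - p) * scale a v q
      + (b - p) * (q - b) * (q - p) / ((v - a) * √(v - a)) ≤ (q - p) * scale a v b := by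
  have hn : 0 < v - a := sub_pos.2 hav
  have hsn : 0 < √(v - a) := Real.sqrt_pos.2 hn
  have hsq : √(v - a) ^ 2 = v - a := Real.sq_sqrt hn.le
  have P := scale_sq hap (hpb.trans (hbq.trans hqv))
  have B := scale_sq (hap.trans hpb) (hbq.trans hqv)
  have Q := scale_sq (hap.trans (hpb.trans hbq)) hqv
  have hP0 := scale_nonneg a v p
  have hB0 := scale_nonneg a v b
  have hQ0 := scale_nonneg a v q
  have bd : ∀ y, a ≤ y → y ≤ v → scale a v y ≤ √(v - a) / 2 := by
    intro y h1 h2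
    have := scale_sq h1 h2
    apply le_of_sq_le_sq _ (by positivity)
    rw [this, div_pow, hsq, div_le_iff₀ hn]
    nlinarith [sq_nonneg ((y - a) - (v - y))]
  have bP := bd p hap (by linarith)
  have bB := bd b (by linarith) (by linarith)
  have bQ := bd q (by linarith) hqv
  set A := (q - b) * scale a v p + (b - p) * scale a v q with hA
  have hA0 : 0 ≤ A := add_nonneg (mul_nonneg (by linarith) hP0) (mul_nonneg (by linarith) hQ0)
  have hAb : A ≤ (q - p) * (√(v - a) / 2) := by
    have := mul_le_mul_of_nonneg_left bP (by linarith : 0 ≤ q - b)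
    have := mul_le_mul_of_nonneg_left bQ (by linarith : 0 ≤ b - p)
    linarith
  have hBb : (q - p) * scale a v b ≤ (q - p) * (√(v - a) / 2) :=
    mul_le_mul_of_nonneg_left bB (by linarith)
  -- `scale` squared is quadratic in its last argument with leading coefficient -1/(v - a); the
  -- square of the chord differs from the chord of the squares by a multiple of (scale p - scale
  -- q)².
  have id1 : ((q - p) * scale a v b) ^ 2 - A ^ 2
      = (b - p) * (q - b) * ((q - p) ^ 2 * (q - p) ^ 2 / ((q - p) ^ 2 * (v - a))
          + (scale a v p - scale a v q) ^ 2) := by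
    have hq : q - p ≠ 0 := by linarith
    have e : ((q - p) * scale a v b) ^ 2 - A ^ 2
      = (q - p) ^ 2 * scale a v b ^ 2 - (q - b) * (q - p) * scale a v p ^ 2
        - (b - p) * (q - p) * scale a v q ^ 2
        + (b - p) * (q - b) * (scale a v p - scale a v q) ^ 2 := by
      rw [hA]; ring
    rw [e, P, B, Q]
    field_simp
    ring
  set S := (q - p) * scale a v b with hS
  have hS0 : 0 ≤ S := mul_nonneg (by linarith) hB0
  have id2 : (b - p) * (q - b) * ((q - p) ^ 2 / (v - a)) ≤ (S - A) * (S + A) := by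
    have hq : q - p ≠ 0 := by linarith
    have : (q - p) ^ 2 * (q - p) ^ 2 / ((q - p) ^ 2 * (v - a)) = (q - p) ^ 2 / (v - a) := by
      field_simp
    rw [this] at id1
    have h0 : 0 ≤ (b - p) * (q - b) := mul_nonneg (by linarith) (by linarith)
    nlinarith [mul_nonneg h0 (sq_nonneg (scale a v p - scale a v q))]
  have hSA : A ≤ S := by
    by_contra hlt
    push Not at hlt
    have h0 : 0 ≤ (b - p) * (q - b) * ((q - p) ^ 2 / (v - a)) :=
      mul_nonneg (mul_nonneg (by linarith) (by linarith)) (by positivity)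
    nlinarith
  -- Passing from squares back to `S - A` costs the factor `S + A`, which is bounded because `scale`
  -- is at most √(v - a) / 2.
  have h3 : (S - A) * (S + A) ≤ (S - A) * ((q - p) * √(v - a)) :=
    mul_le_mul_of_nonneg_left (by linarith) (by linarith)
  have h4 : (b - p) * (q - b) * (q - p) / ((v - a) * √(v - a)) ≤ S - A := by
    have h5 := id2.trans h3
    have hq : 0 < q - p := by linarith
    rw [div_le_iff₀ (by positivity)]
    have h6 : (b - p) * (q - b) * ((q - p) ^ 2 / (v - a)) * (v - a)
        ≤ (S - A) * ((q - p) * √(v - a)) * (v - a) :=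
      mul_le_mul_of_nonneg_right h5 hn.le
    have e7 : (b - p) * (q - b) * ((q - p) ^ 2 / (v - a)) * (v - a)
        = (q - p) * ((b - p) * (q - b) * (q - p)) := by field_simp
    rw [e7] at h6
    have h8 : (q - p) * ((b - p) * (q - b) * (q - p)) ≤
        (q - p) * ((S - A) * ((v - a) * √(v - a))) := by
      linarith
    exact le_of_mul_le_mul_left h8 hq
  linarith

theorem scale_self_left (a v : ℝ) : scale a v a = 0 := by simp [scale]

theorem scale_self_right (a v : ℝ) : scale a v v = 0 := by simp [scale]

theorem centredSum_self_left (x : ℕ → ℝ) (a v : ℕ) : centredSum x a v a = 0 := by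
  simp [centredSum]

theorem centredSum_self_right (x : ℕ → ℝ) {a v : ℕ} (h : a < v) : centredSum x a v v = 0 := by
  have : (v : ℝ) - a ≠ 0 := by
    have : (a : ℝ) < v := by exact_mod_cast h
    linarith
  simp [centredSum, div_self this]

/-- With r₁ = √d₁ and r₂ = √d₂, a factor r₁ r₂ cancels; then square, use (r₁ + r₂)² ≤ 2 (d₁ + d₂),
and cancel d₁ + d₂. -/
theorem mul_le_of_mul_sqrt_le {d₁ d₂ G lam n3 : ℝ} (hd₁ : 0 < d₁) (hd₂ : 0 ≤ d₂) (hG : 0 < G)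
    (hn3 : 0 < n3) (key : G * (d₁ * d₂ * (d₁ + d₂) / n3) ≤ lam * (d₂ * √d₁ + d₁ * √d₂)) :
    d₁ * d₂ * (G ^ 2 * (d₁ + d₂)) ≤ 2 * lam ^ 2 * n3 ^ 2 := by
  have s1 := Real.sq_sqrt hd₁.le
  have s2 := Real.sq_sqrt hd₂
  have hr₁0 : 0 < √d₁ := Real.sqrt_pos.2 hd₁
  have hr₂0 : 0 ≤ √d₂ := Real.sqrt_nonneg _
  generalize √d₁ = r₁ at *
  generalize √d₂ = r₂ at *
  rcases hr₂0.eq_or_lt with h0 | hr₂0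
  · rw [← s2, ← h0]
    simp
    positivity
  have k2 : G * (r₁ * r₂) * (d₁ + d₂) ≤ lam * (r₁ + r₂) * n3 := by
    have : G * (d₁ * d₂ * (d₁ + d₂) / n3) = (r₁ * r₂) * (G * (r₁ * r₂) * (d₁ + d₂)) / n3 := by
      rw [← s1, ← s2]; ring
    rw [this, div_le_iff₀ hn3] at key
    have e : lam * (d₂ * r₁ + d₁ * r₂) * n3 = (r₁ * r₂) * (lam * (r₁ + r₂) * n3) := by
      rw [← s1, ← s2]; ring
    rw [e] at key
    exact le_of_mul_le_mul_left key (by positivity)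
  have hdd : 0 < d₁ + d₂ := by rw [← s1]; positivity
  have k3 : (G * (r₁ * r₂) * (d₁ + d₂)) ^ 2 ≤ (lam * (r₁ + r₂) * n3) ^ 2 :=
    pow_le_pow_left₀ (by positivity) k2 2
  have k4 : (r₁ + r₂) ^ 2 ≤ 2 * (d₁ + d₂) := by
    linear_combination sq_nonneg (r₁ - r₂) + 2 * s1 + 2 * s2
  have k5 : (lam * (r₁ + r₂) * n3) ^ 2 ≤ (d₁ + d₂) * (2 * lam ^ 2 * n3 ^ 2) := by
    have := mul_le_mul_of_nonneg_left k4 (by positivity : 0 ≤ lam ^ 2 * n3 ^ 2)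
    linear_combination this
  have k6 : (G * (r₁ * r₂) * (d₁ + d₂)) ^ 2 = (d₁ + d₂) * (d₁ * d₂ * (G ^ 2 * (d₁ + d₂))) := by
    rw [← s1, ← s2]; ring
  rw [k6] at k3
  exact le_of_mul_le_mul_left (k3.trans k5) hdd

/-- Localisation: the arg-max `b` of the CUSUM, if its value `G` is large, is close to one end of
any stretch `(p, q]` around `b` on which the signal is constant. This is the case of a positive
CUSUM at `b`. -/
theorem mul_le_of_cusum_max_of_pos {x f ε : ℕ → ℝ} {a v b p q : ℕ} {c G lam : ℝ}
    (hx : ∀ t, x t = f t + ε t) (hε : SumBound ε (a + 1) v lam)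
    (hap : a ≤ p) (hpb : p < b) (hbq : b ≤ q) (hqv : q ≤ v) (hbv : b < v)
    (hf : ∀ t, p < t → t ≤ q → f t = c) (hG : 0 < G) (hb : cusum x (a + 1) v b = G)
    (hmax : ∀ r, a < r → r < v → |cusum x (a + 1) v r| ≤ G) :
    ((b : ℝ) - p) * ((q : ℝ) - b) * (G ^ 2 * ((q : ℝ) - p))
      ≤ 2 * lam ^ 2 * ((v : ℝ) - a) ^ 3 := by
  have r1 : (a : ℝ) ≤ p := by exact_mod_cast hap
  have r2 : (p : ℝ) < b := by exact_mod_cast hpb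
  have r3 : (b : ℝ) ≤ q := by exact_mod_cast hbq
  have r4 : (q : ℝ) ≤ v := by exact_mod_cast hqv
  have hn : (0 : ℝ) < (v : ℝ) - a := by linarith
  -- Maximality of `b`: the centred sum lies below `G * scale`, also at the ends of the interval,
  -- where both vanish.
  have Yle : ∀ r : ℕ, a ≤ r → r ≤ v → centredSum x a v r ≤ G * scale a v r := by
    intro r h1 h2
    rcases h1.eq_or_lt with rfl | h1
    · rw [centredSum_self_left, scale_self_left, mul_zero]
    rcases h2.eq_or_lt with rfl | h2
    · rw [centredSum_self_right x h1, scale_self_right, mul_zero]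
    rw [← cusum_mul_scale x h1 h2]
    exact mul_le_mul_of_nonneg_right ((le_abs_self _).trans (hmax r h1 h2)) (scale_nonneg _ _ _)
  have Yb : centredSum x a v b = G * scale a v b := by
    rw [← hb, cusum_mul_scale x (by omega) hbv]
  have Yp := Yle p hap (by omega)
  have Yq := Yle q (by omega) hqv
  have e1 := hε.psum (by omega : a + 1 ≤ p + 1) hpb.le (by omega : b ≤ v)
  have e2 := hε.psum (by omega : a + 1 ≤ b + 1) hbq hqv
  have f1 := psum_sub_of_const (x := f) (c := c) hpb.le fun t h1 h2 => hf t h1 (h2.trans hbq)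
  have f2 := psum_sub_of_const (x := f) (c := c) hbq fun t h1 h2 => hf t (hpb.trans h1) h2
  have px : ∀ r, psum x r = psum f r + psum ε r := by
    intro r
    rw [← psum_add]
    congr 1
    funext t
    exact hx t
  -- A weighted second difference at p, b, q: the linear term and the constant level `c` drop out,
  -- and only noise remains.
  have id1 : ((q : ℝ) - p) * centredSum x a v b
      = ((q : ℝ) - b) * centredSum x a v p + ((b : ℝ) - p) * centredSum x a v q
        + (((q : ℝ) - b) * (psum ε b - psum ε p) - ((b : ℝ) - p) * (psum ε q - psum ε b)) := by
    have g1 : psum x b - psum x p = ((b : ℝ) - p) * c + (psum ε b - psum ε p) := by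
      rw [px, px]; linarith
    have g2 : psum x q - psum x b = ((q : ℝ) - b) * c + (psum ε q - psum ε b) := by
      rw [px, px]; linarith
    have : ((q : ℝ) - p) * centredSum x a v b
      - (((q : ℝ) - b) * centredSum x a v p + ((b : ℝ) - p) * centredSum x a v q)
      = ((q : ℝ) - b) * (psum x b - psum x p) - ((b : ℝ) - p) * (psum x q - psum x b) := by
      unfold centredSum
      field_simp
      ring
    rw [g1, g2] at this
    linarith
  have cc := scale_strongly_concave (a := (a : ℝ)) (v := v) (p := p) (b := b) (q := q)
    (by linarith) r1 r2.le r3 r4 (by linarith)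
  set d₁ := (b : ℝ) - p with hd₁
  set d₂ := (q : ℝ) - b with hd₂
  have hd₁0 : 0 ≤ d₁ := by linarith
  have hd₂0 : 0 ≤ d₂ := by linarith
  have hm : (q : ℝ) - p = d₁ + d₂ := by rw [hd₁, hd₂]; ring
  rw [hm] at id1 cc ⊢
  have hn3 : 0 < ((v : ℝ) - a) * √((v : ℝ) - a) := mul_pos hn (Real.sqrt_pos.2 hn)
  set n3 := ((v : ℝ) - a) * √((v : ℝ) - a) with hn3d
  have key : G * (d₁ * d₂ * (d₁ + d₂) / n3) ≤ lam * (d₂ * √d₁ + d₁ * √d₂) := by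
    have t1 := mul_le_mul_of_nonneg_left Yp hd₂0
    have t2 := mul_le_mul_of_nonneg_left Yq hd₁0
    have t3 := mul_le_mul_of_nonneg_left cc hG.le
    have t4 := mul_le_mul_of_nonneg_left ((le_abs_self _).trans e1) hd₂0
    have t5 := mul_le_mul_of_nonneg_left ((neg_le_abs _).trans e2) hd₁0
    rw [Yb] at id1
    linear_combination t1 + t2 + t3 + t4 + t5 + id1
  have n3sq : n3 ^ 2 = ((v : ℝ) - a) ^ 3 := by
    rw [hn3d, mul_pow, Real.sq_sqrt hn.le]
    ring
  rw [← n3sq]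
  exact mul_le_of_mul_sqrt_le (by linarith) hd₂0 hG hn3 key

/-- Localisation of the arg-max of the absolute CUSUM within a stretch on which the signal is
constant. -/
theorem mul_le_of_cusum_max {x f ε : ℕ → ℝ} {a v b p q : ℕ} {c lam : ℝ}
    (hx : ∀ t, x t = f t + ε t) (hε : SumBound ε (a + 1) v lam)
    (hap : a ≤ p) (hpb : p < b) (hbq : b ≤ q) (hqv : q ≤ v) (hbv : b < v)
    (hf : ∀ t, p < t → t ≤ q → f t = c) (hb : cusum x (a + 1) v b ≠ 0)
    (hmax : ∀ r, a < r → r < v → |cusum x (a + 1) v r| ≤ |cusum x (a + 1) v b|) :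
    ((b : ℝ) - p) * ((q : ℝ) - b) * (|cusum x (a + 1) v b| ^ 2 * ((q : ℝ) - p))
      ≤ 2 * lam ^ 2 * ((v : ℝ) - a) ^ 3 := by
  rcases lt_or_gt_of_ne hb with h | h
  · refine mul_le_of_cusum_max_of_pos (x := fun t => -x t) (f := fun t => -f t)
      (ε := fun t => -ε t) (c := -c) (fun t => ?_) hε.neg hap hpb hbq hqv hbv
      (fun t h1 h2 => by rw [hf t h1 h2]) (abs_pos.2 hb) ?_ ?_
    · rw [hx t]; ring
    · rw [cusum_neg, abs_of_neg h]
    · intro r h1 h2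
      rw [cusum_neg, abs_neg]
      exact hmax r h1 h2
  · exact mul_le_of_cusum_max_of_pos hx hε hap hpb hbq hqv hbv hf (abs_pos.2 hb)
      (abs_of_pos h).symm hmax

/-! ### The deterministic regime. -/

/-- The size of the jump of `f` at the `i`-th change-point. -/
def jump (f : ℕ → ℝ) (η : ℕ → ℕ) (i : ℕ) : ℝ := |f (η i) - f (η i - 1)|

/-- `x` is an acceptable estimate of the `i`-th change-point: the distance is at most `W` divided
by the squared jump. The ends of the sample count as `η 0` and `η (N + 1)`. -/
def Near (f : ℕ → ℝ) (η : ℕ → ℕ) (T N : ℕ) (W : ℝ) (i x : ℕ) : Prop :=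
  (i = 0 ∧ x = 0) ∨ (i = N + 1 ∧ x = T) ∨
    (1 ≤ i ∧ i ≤ N ∧ |(η i : ℝ) - x| * jump f η i ^ 2 ≤ W)

/-- The interval `p` contains the `k`-th change-point, and extends by at least `h` and by less than
`2 * h` to both sides of it. -/
def Favourable (η : ℕ → ℕ) (h k : ℕ) (p : ℕ × ℕ) : Prop :=
  η k < p.1 + 2 * h ∧ p.1 + h ≤ η k ∧ η k + h ≤ p.2 ∧ p.2 < η k + 2 * h

/-- The signal with the values before `η i` and from `η j` on replaced by the nearest value
between them. -/
def clampSignal (f : ℕ → ℝ) (η : ℕ → ℕ) (i j t : ℕ) : ℝ :=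
  f (max (η i) (min t (η j - 1)))

/-- The deterministic regime in which the procedure succeeds: the noise is bounded on the scale
`lam`, and the signal dominates. -/
structure Regime (f ε : ℕ → ℝ) (T N : ℕ) (η : ℕ → ℕ) (δ W lam fmin : ℝ) : Prop where
  cp : IsChangePoints f T N η
  δ_pos : 0 < δ
  spacing : ∀ i ≤ N, δ * T ≤ (η (i + 1) : ℝ) - η i
  jump_ge : ∀ i, 1 ≤ i → i ≤ N → fmin ≤ jump f η i
  fmin_pos : 0 < fmin
  noise : SumBound ε 1 T lam
  lam_nonneg : 0 ≤ lam
  -- Localisation in `exists_near` yields 128 · 512² lam² / δ⁷, which has to be at most W / 2.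
  -- Errors inherited from larger domains do not enter.
  W_ge : 256 * 512 ^ 2 * lam ^ 2 ≤ W * δ ^ 7
  W_le : W ≤ δ ^ 3 * T / 2048 * fmin ^ 2
  length_ge : 2048 ≤ δ ^ 3 * T
  signal_ge : 2 * (lam + √(3 * W)) ≤ fmin * √(δ * T / 32) / 2
  -- Makes a shift by one time point cost at most W / 2: splits are last times of a segment,
  -- change-points are first times of the next.
  jump_le : ∀ i, 1 ≤ i → i ≤ N → 2 * jump f η i ^ 2 ≤ W

namespace Regime

variable {f ε : ℕ → ℝ} {T N : ℕ} {η : ℕ → ℕ} {δ W lam fmin : ℝ}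

theorem W_nonneg (H : Regime f ε T N η δ W lam fmin) : 0 ≤ W := by
  have h := H.W_ge
  have h1 : 0 ≤ W * δ ^ 7 := le_trans (by positivity) h
  exact nonneg_of_mul_nonneg_left h1 (pow_pos H.δ_pos 7)

theorem length_pos (H : Regime f ε T N η δ W lam fmin) : (0 : ℝ) < T := by
  have h := H.length_ge
  have := pow_pos H.δ_pos 3
  by_contra h0
  push Not at h0
  nlinarith

theorem spacing_add (H : Regime f ε T N η δ W lam fmin) {i j : ℕ} (hij : i ≤ j)
    (hj : j ≤ N + 1) : δ * T * ((j : ℝ) - i) ≤ (η j : ℝ) - η i := by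
  induction j, hij using Nat.le_induction with
  | base => simp
  | succ j hij ih =>
    have h1 := ih (by omega)
    have h2 := H.spacing j (by omega)
    push_cast
    linarith

theorem eta_mono (H : Regime f ε T N η δ W lam fmin) {i j : ℕ} (hij : i ≤ j)
    (hj : j ≤ N + 1) : η i ≤ η j := by
  induction j, hij using Nat.le_induction with
  | base => rfl
  | succ j hij ih => exact (ih (by omega)).trans (H.cp.lt j (by omega)).le

theorem eta_lt (H : Regime f ε T N η δ W lam fmin) {i j : ℕ} (hij : i < j)
    (hj : j ≤ N + 1) : η i < η j :=
  (H.cp.lt i (by omega)).trans_le (H.eta_mono hij hj)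

theorem one_le_eta (H : Regime f ε T N η δ W lam fmin) {i : ℕ} (hi : i ≤ N + 1) : 1 ≤ η i := by
  rw [← H.cp.zero]
  exact H.eta_mono (Nat.zero_le i) hi

theorem eta_le (H : Regime f ε T N η δ W lam fmin) {i : ℕ} (hi : i ≤ N + 1) : η i ≤ T + 1 := by
  rw [← H.cp.last]
  exact H.eta_mono hi le_rfl

theorem mul_card_le_one (H : Regime f ε T N η δ W lam fmin) : δ * ((N : ℝ) + 1) ≤ 1 := by
  have h := H.spacing_add (Nat.zero_le (N + 1)) le_rfl
  rw [H.cp.zero, H.cp.last] at h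
  push_cast at h
  have hT := H.length_pos
  have : T * (δ * ((N : ℝ) + 1)) ≤ T * 1 := by linarith
  exact le_of_mul_le_mul_left this hT

theorem δ_le_one (H : Regime f ε T N η δ W lam fmin) : δ ≤ 1 := by
  have h := H.mul_card_le_one
  have : 0 ≤ δ * (N : ℝ) := mul_nonneg H.δ_pos.le (Nat.cast_nonneg _)
  linarith

theorem cube_le (H : Regime f ε T N η δ W lam fmin) : δ ^ 3 * T ≤ δ * T := by
  have h1 : δ ^ 3 ≤ δ := pow_le_of_le_one H.δ_pos.le H.δ_le_one (by norm_num)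
  exact mul_le_mul_of_nonneg_right h1 H.length_pos.le

theorem abs_sub_le_of_near (H : Regime f ε T N η δ W lam fmin) {i x : ℕ}
    (h : Near f η T N W i x) : |(η i : ℝ) - x| ≤ δ ^ 3 * T / 2048 := by
  have hL := H.length_ge
  rcases h with ⟨rfl, rfl⟩ | ⟨rfl, rfl⟩ | ⟨h1, h2, h3⟩
  · rw [H.cp.zero]
    norm_num
    linarith
  · rw [H.cp.last]
    push_cast
    rw [add_sub_cancel_left, abs_one]
    linarith
  · have h4 : fmin ^ 2 ≤ jump f η i ^ 2 :=
      pow_le_pow_left₀ H.fmin_pos.le (H.jump_ge i h1 h2) 2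
    have h5 := mul_le_mul_of_nonneg_left h4 (abs_nonneg ((η i : ℝ) - x))
    exact le_of_mul_le_mul_right (h5.trans (h3.trans H.W_le)) (pow_pos H.fmin_pos 2)

theorem exists_segment {η : ℕ → ℕ} {i j t : ℕ} (hij : i < j) (h1 : η i ≤ t) (h2 : t < η j) :
    ∃ r, i ≤ r ∧ r < j ∧ η r ≤ t ∧ t < η (r + 1) := by
  induction j, hij using Nat.le_induction with
  | base => exact ⟨i, le_rfl, Nat.lt_succ_self i, h1, h2⟩
  | succ j hij ih =>
    by_cases h : t < η j
    · obtain ⟨r, a1, a2, a3⟩ := ih h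
      exact ⟨r, a1, by omega, a3⟩
    · exact ⟨j, by omega, by omega, by omega, h2⟩

theorem eq_pred (H : Regime f ε T N η δ W lam fmin) {k : ℕ} (hk : k ≤ N) :
    f (η (k + 1) - 1) = f (η k) := by
  have := H.cp.lt k hk
  exact H.cp.const k hk _ (by omega) (by omega)

theorem abs_sub_le (H : Regime f ε T N η δ W lam fmin) {i r : ℕ} {F : ℝ} (hir : i ≤ r)
    (hr : r ≤ N) (hF : ∀ k, i < k → k ≤ r → jump f η k ≤ F) :
    |f (η r) - f (η i)| ≤ ((r : ℝ) - i) * F := by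
  induction r, hir using Nat.le_induction with
  | base => simp
  | succ r hir ih =>
    have h1 := ih (by omega) fun k h1 h2 => hF k h1 (by omega)
    have h2 := hF (r + 1) (by omega) le_rfl
    rw [jump, H.eq_pred (by omega : r ≤ N)] at h2
    have h3 := _root_.abs_sub_le (f (η (r + 1))) (f (η r)) (f (η i))
    push_cast
    linarith

theorem abs_clampSignal_sub_le (H : Regime f ε T N η δ W lam fmin) {i j : ℕ} {F : ℝ}
    (hij : i < j) (hj : j ≤ N + 1) (hF0 : 0 ≤ F) (hF : ∀ k, i < k → k < j → jump f η k ≤ F)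
    (t : ℕ) : |clampSignal f η i j t - f (η i)| ≤ N * F := by
  have h := H.eta_lt hij hj
  obtain ⟨r, h1, h2, h3, h4⟩ := exists_segment hij
    (le_max_left (η i) (min t (η j - 1))) (by omega)
  rw [clampSignal, H.cp.const r (by omega) _ h3 h4]
  refine (H.abs_sub_le h1 (by omega) fun k a1 a2 => hF k a1 (by omega)).trans
    (mul_le_mul_of_nonneg_right ?_ hF0)
  have : (r : ℝ) ≤ N := by exact_mod_cast (by omega : r ≤ N)
  have : (0 : ℝ) ≤ i := Nat.cast_nonneg i
  linarith

/-- The ends are off by less than a segment length, so outside [η i, η j) the domain meets only the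
two adjacent segments, where the clamped signal is wrong by exactly one jump. -/
theorem sq_sub_clampSignal_le (H : Regime f ε T N η δ W lam fmin) {i j x e t : ℕ} (hij : i < j)
    (hj : j ≤ N + 1) (heT : e ≤ T) (hx : Near f η T N W i x) (he : Near f η T N W j e)
    (h1 : x < t) (h2 : t ≤ e) :
    (f t - clampSignal f η i j t) ^ 2 ≤
      (if t < η i then jump f η i ^ 2 else 0) + (if η j ≤ t then jump f η j ^ 2 else 0) := by
  have hlt := H.eta_lt hij hj
  have hx' := abs_le.1 (H.abs_sub_le_of_near hx)
  have he' := abs_le.1 (H.abs_sub_le_of_near he)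
  have hc := H.cube_le
  have hL := H.length_ge
  by_cases c1 : t < η i
  · have hi0 : i ≠ 0 := by
      rintro rfl
      rw [H.cp.zero] at c1
      omega
    obtain ⟨k, rfl⟩ := Nat.exists_eq_succ_of_ne_zero hi0
    rw [Nat.succ_eq_add_one] at *
    have hs := H.spacing k (by omega)
    have hkt : η k ≤ t := by
      have : (η k : ℝ) ≤ x := by linarith [hx'.2]
      have : η k ≤ x := by exact_mod_cast this
      omega
    rw [if_pos c1, if_neg (by omega), add_zero, clampSignal,
      show max (η (k + 1)) (min t (η j - 1)) = η (k + 1) by omega, jump, sq_abs,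
      H.cp.const k (by omega) t hkt c1, H.eq_pred (by omega : k ≤ N)]
    exact (sub_sq_comm _ _).le
  · by_cases c2 : η j ≤ t
    · have hjN : j ≤ N := by
        by_contra h
        have : j = N + 1 := by omega
        rw [this, H.cp.last] at c2
        omega
      have hs := H.spacing j hjN
      have hkt : t < η (j + 1) := by
        have : (e : ℝ) < η (j + 1) := by linarith [he'.1]
        have : e < η (j + 1) := by exact_mod_cast this
        omega
      rw [if_neg c1, if_pos c2, zero_add, clampSignal,
        show max (η i) (min t (η j - 1)) = η j - 1 by omega, jump, sq_abs,
        H.cp.const j hjN t c2 hkt]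
    · rw [if_neg c1, if_neg c2, clampSignal, show max (η i) (min t (η j - 1)) = t by omega]
      simp

theorem sum_sq_sub_clampSignal_le (H : Regime f ε T N η δ W lam fmin) {i j x e : ℕ} (hij : i < j)
    (hj : j ≤ N + 1) (heT : e ≤ T) (hx : Near f η T N W i x) (he : Near f η T N W j e) :
    ∑ t ∈ Finset.Icc (x + 1) e, (f t - clampSignal f η i j t) ^ 2 ≤ 3 * W := by
  have hW := H.W_nonneg
  have hlt := H.eta_lt hij hj
  have h1 : ∑ t ∈ Finset.Icc (x + 1) e, (if t < η i then jump f η i ^ 2 else 0) ≤ W := by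
    rw [← Finset.sum_filter, Finset.sum_const, nsmul_eq_mul]
    have hsub : (Finset.Icc (x + 1) e).filter (fun t => t < η i) ⊆ Finset.Ico (x + 1) (η i) := by
      intro t ht
      rw [Finset.mem_filter, Finset.mem_Icc] at ht
      rw [Finset.mem_Ico]
      omega
    have hcard := Finset.card_le_card hsub
    rw [Nat.card_Ico] at hcard
    rcases hx with ⟨rfl, rfl⟩ | ⟨rfl, rfl⟩ | ⟨a1, a2, a3⟩
    · rw [H.cp.zero] at *
      rw [Nat.le_zero.1 hcard]
      simpa using hW
    · omega
    · refine le_trans (mul_le_mul_of_nonneg_right ?_ (sq_nonneg _)) a3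
      have : ((Finset.card ((Finset.Icc (x + 1) e).filter (fun t => t < η i)) : ℕ) : ℝ)
          ≤ ((η i - (x + 1) : ℕ) : ℝ) := by exact_mod_cast hcard
      refine this.trans ?_
      by_cases hc : x + 1 ≤ η i
      · rw [Nat.cast_sub hc]
        push_cast
        linarith [le_abs_self ((η i : ℝ) - x)]
      · rw [Nat.sub_eq_zero_of_le (by omega), Nat.cast_zero]
        exact abs_nonneg _
  -- The times from η j to e number up to |η j - e| + 1. The extra one is why the bound is 2 W here
  -- and W on the left.
  have h2 : ∑ t ∈ Finset.Icc (x + 1) e, (if η j ≤ t then jump f η j ^ 2 else 0) ≤ 2 * W := by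
    rw [← Finset.sum_filter, Finset.sum_const, nsmul_eq_mul]
    have hsub : (Finset.Icc (x + 1) e).filter (fun t => η j ≤ t) ⊆ Finset.Icc (η j) e := by
      intro t ht
      rw [Finset.mem_filter, Finset.mem_Icc] at ht
      rw [Finset.mem_Icc]
      omega
    have hcard := Finset.card_le_card hsub
    rw [Nat.card_Icc] at hcard
    rcases he with ⟨rfl, rfl⟩ | ⟨rfl, rfl⟩ | ⟨a1, a2, a3⟩
    · omega
    · rw [H.cp.last] at hcard ⊢
      have : (Finset.filter (fun t => e + 1 ≤ t) (Finset.Icc (x + 1) e)).card = 0 := by omega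
      rw [this]
      simpa using hW
    · have hJ := H.jump_le j a1 a2
      have hcast : ((Finset.card ((Finset.Icc (x + 1) e).filter (fun t => η j ≤ t)) : ℕ) : ℝ)
          ≤ ((e + 1 - η j : ℕ) : ℝ) := by exact_mod_cast hcard
      have hle : ((e + 1 - η j : ℕ) : ℝ) ≤ |(η j : ℝ) - e| + 1 := by
        by_cases hc : η j ≤ e + 1
        · rw [Nat.cast_sub hc]
          push_cast
          linarith [neg_le_abs ((η j : ℝ) - e)]
        · rw [Nat.sub_eq_zero_of_le (by omega), Nat.cast_zero]
          positivity
      have := mul_le_mul_of_nonneg_right (hcast.trans hle) (sq_nonneg (jump f η j))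
      linarith
  refine (Finset.sum_le_sum fun t ht => ?_).trans
    ((Finset.sum_add_distrib ..).trans_le (add_le_add h1 h2) |>.trans_eq (by ring))
  rw [Finset.mem_Icc] at ht
  exact H.sq_sub_clampSignal_le hij hj heT hx he (by omega) ht.2

/-- On a domain which extends approximately from `η i` to `η j`, the CUSUM is bounded in terms of
the intermediate jumps and the noise. -/
theorem abs_cusum_le (H : Regime f ε T N η δ W lam fmin) {X : ℕ → ℝ}
    (hX : ∀ t, X t = f t + ε t) {i j x e : ℕ} {F : ℝ} (hij : i < j)
    (hj : j ≤ N + 1) (heT : e ≤ T) (hx : Near f η T N W i x) (he : Near f η T N W j e)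
    (hF0 : 0 ≤ F) (hF : ∀ k, i < k → k < j → jump f η k ≤ F)
    {a v b : ℕ} (hxa : x ≤ a) (hab : a < b) (hbv : b < v) (hve : v ≤ e) :
    |cusum X (a + 1) v b| ≤ 2 * (N * F) * scale a v b + 2 * (lam + √(3 * W)) := by
  have hX' : X = fun t => clampSignal f η i j t + (ε t + (f t - clampSignal f η i j t)) := by
    funext t
    rw [hX t]
    ring
  have h1 : SumBound (fun t => ε t + (f t - clampSignal f η i j t)) (a + 1) v (lam + √(3 * W)) :=
    (H.noise.mono (by omega) (by omega)).add
      ((sumBound_of_sum_sq_le (H.sum_sq_sub_clampSignal_le hij hj heT hx he)).mono (by omega) hve)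
  rw [hX', cusum_add]
  refine (abs_add_le _ _).trans (add_le_add ?_ ?_)
  · exact abs_cusum_le_of_abs_sub_le
      (fun t _ _ => H.abs_clampSignal_sub_le hij hj hF0 hF t) hab hbv
  · exact h1.abs_cusum_le (add_nonneg H.lam_nonneg (Real.sqrt_nonneg _)) hab hbv

/-- Since `2 * h` is about half the minimal spacing, such an interval contains no other
change-point. -/
theorem favourable_bounds (H : Regime f ε T N η δ W lam fmin) {h k : ℕ} {p : ℕ × ℕ}
    (hh : h = ⌈δ * T / 4⌉₊) (h1 : 1 ≤ k) (h2 : k ≤ N) (hp : Favourable η h k p) :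
    1 ≤ h ∧ η (k - 1) < p.1 ∧ p.2 < η (k + 1) := by
  have hc := H.cube_le
  have hL := H.length_ge
  have hh' : (h : ℝ) < δ * T / 4 + 1 := by
    rw [hh]
    exact Nat.ceil_lt_add_one (by linarith)
  have hh'' : δ * T / 4 ≤ (h : ℝ) := by
    rw [hh]
    exact Nat.le_ceil _
  have s1 := H.spacing k h2
  have s2 := H.spacing (k - 1) (by omega)
  rw [Nat.sub_add_cancel h1] at s2
  obtain ⟨p1, p2, p3, p4⟩ := hp
  have p1' : (η k : ℝ) < p.1 + 2 * h := by exact_mod_cast p1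
  have p4' : (p.2 : ℝ) < η k + 2 * h := by exact_mod_cast p4
  refine ⟨?_, ?_, ?_⟩
  · have : (0 : ℝ) < h := by linarith
    exact_mod_cast this
  · have : (η (k - 1) : ℝ) < p.1 := by linarith
    exact_mod_cast this
  · have : (p.2 : ℝ) < η (k + 1) := by linarith
    exact_mod_cast this

/-- On such an interval the signal has a single jump, with at least δT/4 points on each side, so its
CUSUM at the jump is the jump times `scale`. -/
theorem le_abs_cusum (H : Regime f ε T N η δ W lam fmin) {X : ℕ → ℝ}
    (hX : ∀ t, X t = f t + ε t) {h k : ℕ} {p : ℕ × ℕ} (hh : h = ⌈δ * T / 4⌉₊)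
    (h1 : 1 ≤ k) (h2 : k ≤ N) (hp : Favourable η h k p) :
    jump f η k * √(δ * T / 32) ≤ |cusum X p.1 p.2 (η k - 1)| := by
  obtain ⟨hh1, b1, b2⟩ := H.favourable_bounds hh h1 h2 hp
  obtain ⟨p1, p2, p3, p4⟩ := hp
  obtain ⟨u, v⟩ := p
  dsimp only at *
  obtain ⟨a, rfl⟩ : ∃ a, u = a + 1 := ⟨u - 1, by omega⟩
  obtain ⟨m, rfl⟩ : ∃ m, k = m + 1 := ⟨k - 1, by omega⟩
  rw [Nat.add_sub_cancel] at b1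
  have e2 := H.eta_le (i := m + 1 + 1) (by omega)
  have hb1 : a < η (m + 1) - 1 := by omega
  have hb2 : η (m + 1) - 1 < v := by omega
  have hX' : X = fun t => f t + ε t := funext hX
  have hc := H.cube_le
  have hL := H.length_ge
  have hh'' : δ * T / 4 ≤ (h : ℝ) := by
    rw [hh]
    exact Nat.le_ceil _
  have hf : |cusum f (a + 1) v (η (m + 1) - 1)|
      = jump f η (m + 1) * scale a v (η (m + 1) - 1 : ℕ) := by
    rw [cusum_of_single_jump hb1 hb2 (c := f (η (m + 1) - 1)) (d := f (η (m + 1))), abs_mul,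
      abs_of_nonneg (scale_nonneg _ _ _), abs_sub_comm, jump]
    · intro t c1 c2
      rw [H.eq_pred (by omega : m ≤ N)]
      exact H.cp.const m (by omega) t (by omega) (by omega)
    · intro t c1 c2
      exact H.cp.const (m + 1) h2 t (by omega) (by omega)
  -- Twice what the conclusion needs; the surplus pays for the noise.
  have hs : 2 * √(δ * T / 32) ≤ scale a v (η (m + 1) - 1 : ℕ) := by
    have e : 2 * √(δ * T / 32) = √(δ * T / 4 / 2) := by
      rw [show δ * T / 4 / 2 = 2 ^ 2 * (δ * T / 32) by ring, Real.sqrt_mul (by norm_num),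
        Real.sqrt_sq (by norm_num)]
    rw [e]
    have q1 : ((a : ℝ) + 1) + h ≤ η (m + 1) := by exact_mod_cast p2
    have q2 : (η (m + 1) : ℝ) + h ≤ v := by exact_mod_cast p3
    have q3 : ((η (m + 1) - 1 : ℕ) : ℝ) = (η (m + 1) : ℝ) - 1 := by
      rw [Nat.cast_sub (by omega), Nat.cast_one]
    rw [q3]
    apply sqrt_le_scale <;> linarith
  have hn := (H.noise.mono (by omega : 1 ≤ a + 1) (by omega : v ≤ T)).abs_cusum_le
    H.lam_nonneg hb1 hb2
  have hJ := H.jump_ge _ h1 h2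
  have hS : 0 ≤ √(δ * T / 32) := Real.sqrt_nonneg _
  have hsg := H.signal_ge
  have hW : 0 ≤ √(3 * W) := Real.sqrt_nonneg _
  have m1 := mul_le_mul_of_nonneg_left hs (H.fmin_pos.le.trans hJ)
  have m2 := mul_le_mul_of_nonneg_right hJ hS
  rw [hX', cusum_add]
  have tri := abs_sub_abs_le_abs_sub (cusum f (a + 1) v (η (m + 1) - 1))
    (-cusum ε (a + 1) v (η (m + 1) - 1))
  rw [abs_neg, sub_neg_eq_add, hf] at tri
  linarith [mul_nonneg H.fmin_pos.le hS]

/-- If the largest jump inside the domain is seen by one of the examined intervals, then the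
arg-max `b` of the CUSUM is far from the ends of its interval. -/
theorem split_far (H : Regime f ε T N η δ W lam fmin) {X : ℕ → ℝ}
    (hX : ∀ t, X t = f t + ε t) {i j x e k : ℕ} (hij : i < j)
    (hj : j ≤ N + 1) (heT : e ≤ T) (hx : Near f η T N W i x) (he : Near f η T N W j e)
    (hk1 : i < k) (hk2 : k < j) (hF : ∀ r, i < r → r < j → jump f η r ≤ jump f η k)
    {a v b : ℕ} (hxa : x ≤ a) (hab : a < b) (hbv : b < v) (hve : v ≤ e)
    (hG : jump f η k * √(δ * T / 32) ≤ |cusum X (a + 1) v b|) :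
    δ ^ 3 * T / 512 ≤ (b : ℝ) - a ∧ δ ^ 3 * T / 512 ≤ (v : ℝ) - b := by
  have hJ := H.jump_ge k (by omega) (by omega)
  have hJ0 : 0 < jump f η k := H.fmin_pos.trans_le hJ
  have hS : 0 ≤ √(δ * T / 32) := Real.sqrt_nonneg _
  have hup := H.abs_cusum_le hX hij hj heT hx he hJ0.le hF hxa hab hbv hve
  have hsg := H.signal_ge
  have m2 := mul_le_mul_of_nonneg_right hJ hS
  have hT := H.length_pos
  have hNδ : δ * N ≤ 1 := by linarith [H.mul_card_le_one, H.δ_pos]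
  have h1 : (a : ℝ) < b := by exact_mod_cast hab
  have h2 : (b : ℝ) < v := by exact_mod_cast hbv
  have hδ := H.δ_pos
  -- Compare with the upper bound for the same CUSUM. Noise and end effects use up at most half of
  -- the lower bound, and the largest jump then cancels.
  have key : √(δ * T / 32) ≤ 4 * N * scale a v b := by
    have : jump f η k * √(δ * T / 32) ≤ jump f η k * (4 * N * scale a v b) := by linarith
    exact le_of_mul_le_mul_left this hJ0
  have key2 : δ * √(δ * T / 32) ≤ 4 * scale a v b := by
    have t1 := mul_le_mul_of_nonneg_left key hδ.le
    have t2 := mul_le_mul_of_nonneg_right hNδ (scale_nonneg a v b)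
    linarith
  have fin : ∀ l : ℝ, 0 ≤ l → scale a v b ≤ √l → δ ^ 3 * T / 512 ≤ l := by
    intro l hl hsl
    have t : δ * √(δ * T / 32) ≤ 4 * √l := by linarith
    have t2 := pow_le_pow_left₀ (by positivity) t 2
    rw [mul_pow, mul_pow, Real.sq_sqrt hl, Real.sq_sqrt (by positivity)] at t2
    linarith
  exact ⟨fin _ (by linarith) (scale_le_sqrt_left h1.le h2),
    fin _ (by linarith) (scale_le_sqrt_right h1 h2.le)⟩

/-- As `b` is far from both ends of the domain, a change-point this close to it lies strictly
between η i and η j. Its jump is at most the k-th, so the bound for jump k transfers; the `+ 1` uses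
up the other W / 2. -/
theorem near_of_abs_sub_le (H : Regime f ε T N η δ W lam fmin) {i j x e k r : ℕ} {dd : ℝ}
    (hj : j ≤ N + 1) (hx : Near f η T N W i x) (he : Near f η T N W j e)
    (hk1 : i < k) (hk2 : k < j) (hF : ∀ r, i < r → r < j → jump f η r ≤ jump f η k)
    {b : ℕ} (hb1 : δ ^ 3 * T / 512 ≤ (b : ℝ) - x) (hb2 : δ ^ 3 * T / 512 ≤ (e : ℝ) - b)
    (hr : r ≤ N + 1) (hd : |(η r : ℝ) - b| ≤ dd + 1) (hdW : dd * jump f η k ^ 2 ≤ W / 2)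
    (hdT : dd ≤ δ ^ 3 * T / 4096) :
    ∃ r, i < r ∧ r < j ∧ Near f η T N W r b := by
  have hx' := abs_le.1 (H.abs_sub_le_of_near hx)
  have he' := abs_le.1 (H.abs_sub_le_of_near he)
  have hd' := abs_le.1 hd
  have hL := H.length_ge
  have hir : i < r := by
    by_contra hc
    have : (η r : ℝ) ≤ η i := by exact_mod_cast H.eta_mono (not_lt.1 hc) (by omega)
    linarith
  have hrj : r < j := by
    by_contra hc
    have : (η j : ℝ) ≤ η r := by exact_mod_cast H.eta_mono (not_lt.1 hc) hr
    linarith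
  refine ⟨r, hir, hrj, Or.inr (Or.inr ⟨by omega, by omega, ?_⟩)⟩
  have hJ0 : 0 ≤ jump f η r := abs_nonneg _
  have h1 := pow_le_pow_left₀ hJ0 (hF r hir hrj) 2
  have h2 := H.jump_le r (by omega) (by omega)
  have h3 := mul_le_mul_of_nonneg_right hd (sq_nonneg (jump f η r))
  have hW := H.W_nonneg
  rcases le_or_gt dd 0 with h0 | h0
  · have := mul_nonneg (neg_nonneg.2 h0) (sq_nonneg (jump f η r))
    linarith
  · have := mul_le_mul_of_nonneg_left h1 h0.le
    linarith

/-- Under the assumptions of `split_far`, the arg-max of the CUSUM is near a change-point inside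
the domain. -/
theorem exists_near (H : Regime f ε T N η δ W lam fmin) {X : ℕ → ℝ}
    (hX : ∀ t, X t = f t + ε t) {i j x e k : ℕ} (hij : i < j)
    (hj : j ≤ N + 1) (heT : e ≤ T) (hx : Near f η T N W i x) (he : Near f η T N W j e)
    (hk1 : i < k) (hk2 : k < j) (hF : ∀ r, i < r → r < j → jump f η r ≤ jump f η k)
    {a v b : ℕ} (hxa : x ≤ a) (hab : a < b) (hbv : b < v) (hve : v ≤ e)
    (hG : jump f η k * √(δ * T / 32) ≤ |cusum X (a + 1) v b|)
    (hmax : ∀ r, a < r → r < v → |cusum X (a + 1) v r| ≤ |cusum X (a + 1) v b|) :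
    ∃ r, i < r ∧ r < j ∧ Near f η T N W r b := by
  obtain ⟨far1, far2⟩ := H.split_far hX hij hj heT hx he hk1 hk2 hF hxa hab hbv hve hG
  have hδ := H.δ_pos
  have hT := H.length_pos
  have hc := H.cube_le
  have hL := H.length_ge
  have hJ := H.jump_ge k (by omega) (by omega)
  have hJ0 : 0 < jump f η k := H.fmin_pos.trans_le hJ
  have hS : 0 < √(δ * T / 32) := Real.sqrt_pos.2 (by positivity)
  have hG0 : 0 < |cusum X (a + 1) v b| := (mul_pos hJ0 hS).trans_le hG
  -- The constant stretch used for localisation is the segment of `b`, cut to the interval (a, v].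
  obtain ⟨r, -, hrN, hr1, hr2⟩ := exists_segment (η := η) (i := 0) (j := N + 1) (t := b) (by omega)
    (by rw [H.cp.zero]; omega) (by rw [H.cp.last]; omega)
  have hspace := H.spacing r (by omega)
  have hηr := H.one_le_eta (i := r) (by omega)
  obtain ⟨y, hy⟩ : ∃ y, η r = y + 1 := ⟨η r - 1, by omega⟩
  obtain ⟨z, hz⟩ : ∃ z, η (r + 1) = z + 1 := ⟨η (r + 1) - 1, by omega⟩
  have hy' : (η r : ℝ) = y + 1 := by exact_mod_cast hy
  have hz' : (η (r + 1) : ℝ) = z + 1 := by exact_mod_cast hz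
  have hpb : max a y < b := by omega
  have hbq : b ≤ min v z := by omega
  have loc := mul_le_of_cusum_max (p := max a y) (q := min v z) (c := f (η r)) hX
    (H.noise.mono (by omega : 1 ≤ a + 1) (by omega : v ≤ T)) (le_max_left _ _) hpb hbq
    (min_le_left _ _) hbv (fun t c1 c2 => H.cp.const r (by omega) t (by omega) (by omega))
    (abs_pos.1 hG0) hmax
  -- If the stretch ends at `a` or at `v`, it is long because `b` is far from there; otherwise it is
  -- a full segment.
  have hm : δ ^ 3 * T / 512 ≤ ((min v z : ℕ) : ℝ) - ((max a y : ℕ) : ℝ) := by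
    have h1 : (b : ℝ) ≤ (min v z : ℕ) := by exact_mod_cast hbq
    have h2 : ((max a y : ℕ) : ℝ) < b := by exact_mod_cast hpb
    rcases max_choice a y with e1 | e1
    · rw [e1] at *
      linarith
    · rcases min_choice v z with e2 | e2
      · rw [e2] at *
        linarith
      · rw [e1, e2]
        linarith
  have hp1 : ((max a y : ℕ) : ℝ) < b := by exact_mod_cast hpb
  have hq1 : (b : ℝ) ≤ (min v z : ℕ) := by exact_mod_cast hbq
  have hnT : (v : ℝ) - a ≤ T := by
    have h1 : (v : ℝ) ≤ T := by exact_mod_cast hve.trans heT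
    have h2 : (0 : ℝ) ≤ a := Nat.cast_nonneg a
    linarith
  have hn0 : (0 : ℝ) ≤ (v : ℝ) - a := by
    have : (a : ℝ) ≤ v := by exact_mod_cast (by omega : a ≤ v)
    linarith
  -- Here `d` is the distance to the nearer end of the stretch, so that `d'` is at least m / 2.
  have close : ∀ d d' m : ℝ, 0 ≤ d → d ≤ d' → d + d' = m → δ ^ 3 * T / 512 ≤ m →
      d * d' * (|cusum X (a + 1) v b| ^ 2 * m) ≤ 2 * lam ^ 2 * ((v : ℝ) - a) ^ 3 →
      d * jump f η k ^ 2 ≤ W / 2 ∧ d ≤ δ ^ 3 * T / 4096 := by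
    intro d d' m hd hdd hm1 hm2 hle
    have hm0 : 0 < m := lt_of_lt_of_le (by positivity) hm2
    have s1 : jump f η k ^ 2 * (δ * T / 32) ≤ |cusum X (a + 1) v b| ^ 2 := by
      have := pow_le_pow_left₀ (by positivity) hG 2
      rwa [mul_pow, Real.sq_sqrt (by positivity)] at this
    have s2 : ((v : ℝ) - a) ^ 3 ≤ (T : ℝ) ^ 3 := pow_le_pow_left₀ hn0 hnT 3
    have s3 : (δ ^ 3 * T / 512) ^ 2 ≤ m ^ 2 := pow_le_pow_left₀ (by positivity) hm2 2
    have s4 : d * (m / 2) * ((jump f η k ^ 2 * (δ * T / 32)) * m) ≤ 2 * lam ^ 2 * (T : ℝ) ^ 3 := by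
      refine le_trans ?_ (hle.trans (mul_le_mul_of_nonneg_left s2 (by positivity)))
      have h1 : m / 2 ≤ d' := by linarith
      have h2 : 0 ≤ d' := hd.trans hdd
      gcongr
    have s5 : d * jump f η k ^ 2 * (δ * T / 64) * (δ ^ 3 * T / 512) ^ 2 ≤
        2 * lam ^ 2 * (T : ℝ) ^ 3 := by
      have t := mul_le_mul_of_nonneg_left s3
        (by positivity : 0 ≤ d * jump f η k ^ 2 * (δ * T / 64))
      linarith
    have s6 : (T : ℝ) ^ 3 * (d * jump f η k ^ 2 * δ ^ 7) ≤
        (T : ℝ) ^ 3 * (128 * 512 ^ 2 * lam ^ 2) := by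
      linarith
    have s7 := le_of_mul_le_mul_left s6 (by positivity)
    have s8 : d * jump f η k ^ 2 ≤ W / 2 := by
      have : d * jump f η k ^ 2 * δ ^ 7 ≤ W / 2 * δ ^ 7 := by linarith [H.W_ge]
      exact le_of_mul_le_mul_right this (by positivity)
    refine ⟨s8, ?_⟩
    have s9 : fmin ^ 2 ≤ jump f η k ^ 2 := pow_le_pow_left₀ H.fmin_pos.le hJ 2
    have s10 := mul_le_mul_of_nonneg_left s9 hd
    have : d * fmin ^ 2 ≤ δ ^ 3 * T / 4096 * fmin ^ 2 := by linarith [H.W_le]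
    exact le_of_mul_le_mul_right this (pow_pos H.fmin_pos 2)
  have hxa' : (x : ℝ) ≤ a := by exact_mod_cast hxa
  have hve' : (v : ℝ) ≤ e := by exact_mod_cast hve
  have hbx : δ ^ 3 * T / 512 ≤ (b : ℝ) - x := by linarith
  have hbe : δ ^ 3 * T / 512 ≤ (e : ℝ) - b := by linarith
  rcases le_total ((b : ℝ) - (max a y : ℕ)) (((min v z : ℕ) : ℝ) - b) with hle | hle
  · obtain ⟨c1, c2⟩ := close _ _ _ (by linarith) hle (by ring) hm loc
    -- The nearer end cannot be `a`: that distance is at least δ³T/512, while `c2` allows at most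
    -- δ³T/4096. So it comes from a change-point.
    rcases max_choice a y with e1 | e1
    · rw [e1] at c2
      linarith
    · rw [e1] at c1 c2 hp1
      refine H.near_of_abs_sub_le hj hx he hk1 hk2 hF hbx hbe (r := r) (by omega) ?_ c1 c2
      rw [hy', abs_le]
      constructor <;> linarith
  · rw [mul_comm ((b : ℝ) - _)] at loc
    obtain ⟨c1, c2⟩ := close _ _ _ (by linarith) hle (by ring) hm loc
    rcases min_choice v z with e1 | e1
    · rw [e1] at c2
      linarith
    · rw [e1] at c1 c2 hq1
      refine H.near_of_abs_sub_le hj hx he hk1 hk2 hF hbx hbe (r := r + 1) (by omega) ?_ c1 c2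
      rw [hz', abs_le]
      constructor <;> linarith

end Regime

/-! ### Structure of the solution path. -/

theorem examined_subset (D : ℕ → ℕ → ℕ → ℕ × ℕ) (M s e : ℕ) :
    examined D M s e ⊆ subintervals s e := by
  unfold examined
  split_ifs
  · exact Finset.Subset.refl _
  · exact Finset.inter_subset_right

theorem mem_subintervals {s e : ℕ} {p : ℕ × ℕ} :
    p ∈ subintervals s e ↔ s ≤ p.1 ∧ p.1 < p.2 ∧ p.2 ≤ e := by
  simp only [subintervals, Finset.mem_filter, Finset.mem_product, Finset.mem_Icc]
  omega

theorem exists_isBest (X : ℕ → ℝ) {I : Finset (ℕ × ℕ)} (hI : I.Nonempty)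
    (h : ∀ p ∈ I, p.1 < p.2) : ∃ c, IsBest X I c := by
  let S : Finset ((_ : ℕ × ℕ) × ℕ) := I.sigma fun p => Finset.Ico p.1 p.2
  have hS : S.Nonempty := by
    obtain ⟨p, hp⟩ := hI
    refine ⟨⟨p, p.1⟩, Finset.mem_sigma.2 ⟨hp, Finset.mem_Ico.2 ⟨le_rfl, h p hp⟩⟩⟩
  obtain ⟨⟨p, b⟩, hpb, hmax⟩ := S.exists_max_image (fun q => |cusum X q.1.1 q.1.2 q.2|) hS
  rw [Finset.mem_sigma, Finset.mem_Ico] at hpb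
  refine ⟨⟨p.1, p.2, b⟩, ⟨hpb.1, hpb.2⟩, fun q hq b' h1 h2 => ?_⟩
  exact hmax ⟨q, b'⟩ (Finset.mem_sigma.2 ⟨hq, Finset.mem_Ico.2 ⟨h1, h2⟩⟩)

theorem solPath_cases (X : ℕ → ℝ) (D : ℕ → ℕ → ℕ → ℕ × ℕ) (M s e : ℕ) :
    ((¬ ∃ c, IsBest X (examined D M s e) c) ∧ solPath X D M s e = []) ∨
    ∃ c, IsBest X (examined D M s e) c ∧
      solPath X D M s e = c :: (solPath X D M s c.split ++ solPath X D M (c.split + 1) e) := by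
  classical
  by_cases h : ∃ c, IsBest X (examined D M s e) c
  · refine Or.inr ⟨h.choose, h.choose_spec, ?_⟩
    rw [solPath, dif_pos h]
  · refine Or.inl ⟨h, ?_⟩
    rw [solPath, dif_neg h]

theorem mag_le_of_mem_solPath {X : ℕ → ℝ} {D : ℕ → ℕ → ℕ → ℕ × ℕ} {M s e : ℕ} {B : ℝ}
    (h : ∀ u v b, s ≤ u → u ≤ b → b < v → v ≤ e → |cusum X u v b| ≤ B) :
    ∀ c ∈ solPath X D M s e, c.mag X ≤ B := by
  induction hn : e - s using Nat.strong_induction_on generalizing s e with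
  | _ n ih =>
    rcases solPath_cases X D M s e with ⟨-, h0⟩ | ⟨c, hc, h0⟩
    · simp [h0]
    · have hb := hc.bounds
      have hm := mem_subintervals.1 (examined_subset D M s e hc.1.1)
      dsimp only at hm
      intro d hd
      rw [h0, List.mem_cons, List.mem_append] at hd
      rcases hd with rfl | hd | hd
      · exact h _ _ _ hm.1 hc.1.2.1 hc.1.2.2 hm.2.2
      · exact ih (c.split - s) (by omega)
          (fun u v b h1 h2 h3 h4 => h u v b h1 h2 h3 (by omega)) rfl d hd
      · exact ih (e - (c.split + 1)) (by omega)
          (fun u v b h1 h2 h3 h4 => h u v b (by omega) h2 h3 h4) rfl d hd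

/-- In every domain which extends approximately from a change-point `η i` to a change-point `η j`
with others between them, a largest intermediate jump is seen by an examined interval. -/
def Covered (f : ℕ → ℝ) (η : ℕ → ℕ) (T N : ℕ) (W : ℝ) (h : ℕ) (D : ℕ → ℕ → ℕ → ℕ × ℕ) (M : ℕ) :
    Prop :=
  ∀ i j x e, i + 2 ≤ j → j ≤ N + 1 → e ≤ T → Near f η T N W i x → Near f η T N W j e →
    ∃ k, i < k ∧ k < j ∧ (∀ r, i < r → r < j → jump f η r ≤ jump f η k) ∧
      ∃ p ∈ examined D M (x + 1) e, Favourable η h k p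

theorem perm_cons_append {α : Type*} {c : α} {Q₁ Q₂ A₁ A₂ B₁ B₂ : List α}
    (h₁ : Q₁.Perm (A₁ ++ B₁)) (h₂ : Q₂.Perm (A₂ ++ B₂)) :
    (c :: (Q₁ ++ Q₂)).Perm ((A₁ ++ c :: A₂) ++ (B₁ ++ B₂)) := by
  rw [← Multiset.coe_eq_coe] at *
  simp only [← Multiset.cons_coe, ← Multiset.coe_add, ← Multiset.singleton_add] at *
  rw [h₁, h₂]
  abel

theorem range'_split {i r j : ℕ} (h1 : i < r) (h2 : r < j) :
    List.range' (i + 1) (j - i - 1)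
      = List.range' (i + 1) (r - i - 1) ++ r :: List.range' (r + 1) (j - r - 1) := by
  rw [← List.range'_succ, show j - i - 1 = (r - i - 1) + (j - r - 1 + 1) by omega,
    ← List.range'_append_1]
  congr 2
  omega

/-- Induction on the number of change-points between the ends. Each split is near one of them, so
the two parts again have near ends, with the same `W`; parts without an intermediate change-point
supply `B`. -/
theorem Regime.exists_solPath_perm {f ε : ℕ → ℝ} {T N : ℕ} {η : ℕ → ℕ} {δ W lam fmin : ℝ}
    (H : Regime f ε T N η δ W lam fmin) {X : ℕ → ℝ} (hX : ∀ t, X t = f t + ε t)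
    {D : ℕ → ℕ → ℕ → ℕ × ℕ} {M h : ℕ} (hh : h = ⌈δ * T / 4⌉₊)
    (hcov : Covered f η T N W h D M) {i j x e : ℕ} (hij : i < j) (hj : j ≤ N + 1) (heT : e ≤ T)
    (hx : Near f η T N W i x) (he : Near f η T N W j e) :
    ∃ A B, (solPath X D M (x + 1) e).Perm (A ++ B) ∧
      List.Forall₂ (fun k c => Near f η T N W k c.split ∧ fmin * √(δ * T / 32) ≤ c.mag X)
        (List.range' (i + 1) (j - i - 1)) A ∧
      ∀ c ∈ B, c.mag X ≤ 2 * (lam + √(3 * W)) := by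
  induction hn : j - i using Nat.strong_induction_on generalizing i j x e with
  | _ n ih =>
    subst hn
    rcases (show j = i + 1 ∨ i + 2 ≤ j by omega) with rfl | hij2
    · refine ⟨[], solPath X D M (x + 1) e, List.Perm.refl _, by simp, mag_le_of_mem_solPath ?_⟩
      intro u v b h1 h2 h3 h4
      obtain ⟨a, rfl⟩ : ∃ a, u = a + 1 := ⟨u - 1, by omega⟩
      -- No intermediate jumps, so `F = 0` and only the noise term survives.
      have := H.abs_cusum_le hX hij hj heT hx he le_rfl (fun k h1 h2 => by omega)
        (by omega : x ≤ a) (by omega : a < b) h3 h4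
      simpa using this
    · obtain ⟨k, hk1, hk2, hF, p, hp, hfav⟩ := hcov i j x e hij2 hj heT hx he
      have hex := exists_isBest X ⟨p, hp⟩ fun q hq =>
        (mem_subintervals.1 (examined_subset D M _ _ hq)).2.1
      rcases solPath_cases X D M (x + 1) e with ⟨h0, -⟩ | ⟨c, hc, h0⟩
      · exact absurd hex h0
      have hlow := H.le_abs_cusum hX hh (by omega : 1 ≤ k) (by omega) hfav
      obtain ⟨fh, -, -⟩ := H.favourable_bounds hh (by omega : 1 ≤ k) (by omega) hfav
      have hG : jump f η k * √(δ * T / 32) ≤ c.mag X := by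
        obtain ⟨f1, f2, f3, f4⟩ := hfav
        exact hlow.trans (hc.2 p hp _ (by omega) (by omega))
      have hm := mem_subintervals.1 (examined_subset D M _ _ hc.1.1)
      have hc1 := hc.1
      have hc2 := hc.2 _ hc.1.1
      have hmag : c.mag X = |cusum X c.left c.right c.split| := rfl
      obtain ⟨a, ha⟩ : ∃ a, c.left = a + 1 := ⟨c.left - 1, by dsimp only at hm; omega⟩
      rw [hmag] at hc2
      rw [hmag] at hG
      dsimp only at hc2 hm
      rw [ha] at hc2 hm hc1 hG
      obtain ⟨r, hr1, hr2, hr⟩ := H.exists_near hX hij hj heT hx he hk1 hk2 hF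
        (by omega : x ≤ a) (by omega : a < c.split) (by omega : c.split < c.right) (by omega)
        hG (fun b h1 h2 => hc2 b (by omega) h2)
      obtain ⟨A₁, B₁, p1, q1, s1⟩ := ih (r - i) (by omega) hr1 (by omega)
        (by omega : c.split ≤ T) hx hr rfl
      obtain ⟨A₂, B₂, p2, q2, s2⟩ := ih (j - r) (by omega) hr2 hj heT hr he rfl
      refine ⟨A₁ ++ c :: A₂, B₁ ++ B₂, ?_, ?_, ?_⟩
      · rw [h0]
        exact perm_cons_append p1 p2
      · rw [range'_split hr1 hr2]
        refine List.rel_append q1 (List.Forall₂.cons ⟨hr, ?_⟩ q2)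
        rw [hmag, ha]
        exact (mul_le_mul_of_nonneg_right (H.jump_ge k (by omega) (by omega))
          (Real.sqrt_nonneg _)).trans hG
      · intro d hd
        rcases List.mem_append.1 hd with hd | hd
        · exact s1 d hd
        · exact s2 d hd

/-! ### Model selection and sorting. -/

/-- The drop at N is at least log (big / small), which exceeds log (1 / β). A later admissible drop
goes from at most `small < ζ` to at least `β * ζ`, hence is below log (1 / β). Earlier indices are
excluded because the next value still exceeds `ζ`. -/
theorem sdllSize_eq {a : ℕ → ℝ} {n N : ℕ} {ζ β big small : ℝ} (hNn : N ≤ n)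
    (hanti : ∀ k l, 1 ≤ k → k ≤ l → l ≤ n → a l ≤ a k)
    (hbig : ∀ k, 1 ≤ k → k ≤ N → big ≤ a k) (hsmall : ∀ k, N < k → k ≤ n → a k ≤ small)
    (hζ : small < ζ) (hζ0 : 0 < ζ) (hβ0 : 0 < β) (hβ1 : β < 1) (hζbig : ζ ≤ β * big) :
    sdllSize a n ζ β = N := by
  classical
  have hbig0 : 0 < big := by
    by_contra h
    have := mul_nonneg hβ0.le (neg_nonneg.2 (not_lt.1 h))
    linarith
  have hζlt : ζ < big := by
    have := mul_lt_mul_of_pos_right hβ1 hbig0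
    linarith
  have hβζ : β * ζ < ζ := by
    have := mul_lt_mul_of_pos_right hβ1 hζ0
    linarith
  have hβζ0 : 0 < β * ζ := mul_pos hβ0 hζ0
  unfold sdllSize
  by_cases hn : n = 0
  · rw [if_pos hn]
    omega
  rw [if_neg hn]
  rcases Nat.eq_zero_or_pos N with rfl | hN
  · rw [if_pos ((hsmall 1 (by omega) (by omega)).trans_lt hζ)]
  rw [if_neg (not_lt.2 (hζlt.le.trans (hbig 1 le_rfl hN)))]
  extract_lets K F
  have hKn : K ≤ n - 1 := Nat.findGreatest_le _
  have hNK : N - 1 ≤ K := by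
    refine Nat.le_findGreatest (by omega) ?_
    rw [Nat.sub_add_cancel hN]
    linarith [hbig N hN le_rfl]
  split_ifs with hK0 hF
  -- `K = 0` together with `N - 1 ≤ K` forces N = 1.
  · omega
  · generalize_proofs hex
    obtain ⟨hk, hmax⟩ := hex.choose_spec
    generalize hex.choose = k at hk hmax
    rw [Finset.mem_filter, Finset.mem_Icc] at hk
    obtain ⟨⟨hk1, hkK⟩, hk2⟩ := hk
    have hPK : β * ζ ≤ a (K + 1) := Nat.findGreatest_of_ne_zero rfl hK0
    have hNk : N ≤ k := by
      by_contra h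
      have := hbig (k + 1) (by omega) (by omega)
      linarith
    by_contra hne
    have h1 : a (N + 1) ≤ small := hsmall (N + 1) (by omega) (by omega)
    have h2 : a k ≤ small := hsmall k (by omega) (by omega)
    have h3 : big ≤ a N := hbig N hN le_rfl
    have h4 : β * ζ ≤ a (k + 1) := hPK.trans (hanti _ _ (by omega) (by omega) (by omega))
    have h5 : a (k + 1) ≤ a (N + 1) := hanti _ _ (by omega) (by omega) (by omega)
    have h6 : a (k + 1) ≤ a k := hanti _ _ (by omega) (by omega) (by omega)
    have hm := hmax N (Finset.mem_filter.2 ⟨Finset.mem_Icc.2 ⟨hN, by omega⟩, h1.trans hζ.le⟩)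
    have hs0 : 0 < small := by linarith
    have l1 := Real.log_le_log (by linarith) h1
    have l2 := Real.log_le_log (by linarith) h2
    have l3 := Real.log_le_log (by linarith) h3
    have l4 := Real.log_le_log hβζ0 h4
    have l5 := Real.log_le_log hζ0 hζbig
    rw [Real.log_mul hβ0.ne' hζ0.ne'] at l4
    rw [Real.log_mul hβ0.ne' hbig0.ne'] at l5
    have l6 := Real.log_lt_log hs0 hζ
    linarith
  · by_contra hne
    exact hF ⟨N, Finset.mem_filter.2 ⟨Finset.mem_Icc.2 ⟨hN, by omega⟩,
      (hsmall (N + 1) (by omega) (by omega)).trans hζ.le⟩⟩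

theorem filter_eq_take {α : Type*} (p : α → Bool) {l : List α}
    (h : l.Pairwise fun x y => p y → p x) : l.filter p = l.take (l.filter p).length := by
  induction l with
  | nil => simp
  | cons x l ih =>
    rw [List.pairwise_cons] at h
    by_cases hx : p x
    · rw [List.filter_cons_of_pos hx, List.length_cons, List.take_succ_cons, ← ih h.2]
    · rw [List.filter_cons_of_neg hx, show l.filter p = [] from
        List.filter_eq_nil_iff.2 fun y hy hpy => hx (h.1 y hy hpy)]
      simp

/-- A path sorted by absolute CUSUMs starts with the candidates with large values. -/
theorem take_perm_of_isSorted {X : ℕ → ℝ} {Q P A B : List Candidate} {big small : ℝ}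
    (hP : IsSorted X Q P) (hQ : Q.Perm (A ++ B)) (hA : ∀ c ∈ A, big ≤ c.mag X)
    (hB : ∀ c ∈ B, c.mag X ≤ small) (hlt : small < big) :
    (P.take A.length).Perm A ∧ (P.drop A.length).Perm B := by
  classical
  have hPAB := hP.1.trans hQ
  have hf : ((A ++ B).filter fun c => decide (big ≤ c.mag X)) = A := by
    rw [List.filter_append, List.filter_eq_self.2, List.filter_eq_nil_iff.2, List.append_nil]
    · intro c hc
      have := hB c hc
      simp only [decide_eq_true_eq, not_le]
      linarith
    · intro c hc
      simpa using hA c hc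
  have h1 := hPAB.filter fun c => decide (big ≤ c.mag X)
  rw [hf] at h1
  have h2 := filter_eq_take (fun c => decide (big ≤ c.mag X)) (l := P) (by
    refine (List.pairwise_map.1 hP.2).imp fun {x y} hxy => ?_
    simp only [decide_eq_true_eq]
    exact fun h => h.trans hxy)
  rw [h1.length_eq] at h2
  have h3 : (P.take A.length).Perm A := h2 ▸ h1
  refine ⟨h3, ?_⟩
  have h4 : (P.take A.length ++ P.drop A.length).Perm (P.take A.length ++ B) := by
    rw [List.take_append_drop]
    exact hPAB.trans (List.Perm.append_right B h3.symm)
  exact (List.perm_append_left_iff _).1 h4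

theorem pathMag_eq {X : ℕ → ℝ} {P : List Candidate} {k : ℕ} (h1 : 1 ≤ k) (h2 : k ≤ P.length) :
    pathMag X P k = (P[k - 1]'(by omega)).mag X := by
  unfold pathMag
  rw [List.getD_eq_getElem _ _ (by rw [List.length_map]; omega), List.getElem_map]

theorem Regime.le_of_near {f ε : ℕ → ℝ} {T N : ℕ} {η : ℕ → ℕ} {δ W lam fmin : ℝ}
    (H : Regime f ε T N η δ W lam fmin) {k l x y : ℕ} (hkl : k < l) (hl : l ≤ N)
    (hx : Near f η T N W k x) (hy : Near f η T N W l y) : x ≤ y := by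
  have h1 := abs_le.1 (H.abs_sub_le_of_near hx)
  have h2 := abs_le.1 (H.abs_sub_le_of_near hy)
  have h3 := H.spacing k (by omega)
  have h4 : (η (k + 1) : ℝ) ≤ η l := by exact_mod_cast H.eta_mono hkl (by omega)
  have := H.cube_le
  have := H.length_ge
  have : (x : ℝ) ≤ y := by linarith
  exact_mod_cast this

theorem Regime.sdll_correct {f ε : ℕ → ℝ} {T N : ℕ} {η : ℕ → ℕ} {δ W lam fmin : ℝ}
    (H : Regime f ε T N η δ W lam fmin) {X : ℕ → ℝ} (hX : ∀ t, X t = f t + ε t)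
    {D : ℕ → ℕ → ℕ → ℕ × ℕ} {M h : ℕ} (hh : h = ⌈δ * T / 4⌉₊)
    (hcov : Covered f η T N W h D M) {P : List Candidate}
    (hP : IsSorted X (solPath X D M 1 T) P) {ζ β : ℝ} (hβ0 : 0 < β) (hβ1 : β < 1)
    (hζ : 2 * (lam + √(3 * W)) < ζ) (hζbig : ζ ≤ β * (fmin * √(δ * T / 32))) :
    sdllN X P ζ β = N ∧
      ∀ i, 1 ≤ i → i ≤ N → |(η i : ℝ) - sdllLoc X P ζ β i| * jump f η i ^ 2 ≤ W := by
  obtain ⟨A, B, hQ, hA, hB⟩ := H.exists_solPath_perm hX hh hcov (Nat.succ_pos N) le_rfl le_rfl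
    (Or.inl ⟨rfl, rfl⟩) (Or.inr (Or.inl ⟨rfl, rfl⟩))
  have hsmall0 : 0 ≤ 2 * (lam + √(3 * W)) := by
    have := H.lam_nonneg
    positivity
  have hζ0 : 0 < ζ := hsmall0.trans_lt hζ
  have hbig : 2 * (lam + √(3 * W)) < fmin * √(δ * T / 32) := by
    have := mul_nonneg (sub_nonneg.2 hβ1.le)
      (mul_nonneg H.fmin_pos.le (Real.sqrt_nonneg (δ * T / 32)))
    linarith
  have hlen : A.length = N := by
    rw [← hA.length_eq, List.length_range']
    omega
  have hget : ∀ k (hk : k < A.length), Near f η T N W (k + 1) A[k].split ∧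
      fmin * √(δ * T / 32) ≤ A[k].mag X := by
    intro k hk
    have := (List.forall₂_iff_get.1 hA).2 k (by rw [hA.length_eq]; exact hk) hk
    simpa [List.get_eq_getElem, List.getElem_range', add_comm] using this
  have hAbig : ∀ c ∈ A, fmin * √(δ * T / 32) ≤ c.mag X := by
    intro c hc
    obtain ⟨k, hk, rfl⟩ := List.getElem_of_mem hc
    exact (hget k hk).2
  obtain ⟨ht, hd⟩ := take_perm_of_isSorted hP hQ hAbig hB hbig
  rw [hlen] at ht hd
  have hNP : N ≤ P.length := by
    have := ht.length_eq
    rw [List.length_take, hlen] at this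
    omega
  have hN : sdllN X P ζ β = N := by
    refine sdllSize_eq hNP ?_ ?_ ?_ hζ hζ0 hβ0 hβ1 hζbig
    · intro k l hk hkl hl
      rw [pathMag_eq hk (hkl.trans hl), pathMag_eq (hk.trans hkl) hl]
      rcases hkl.eq_or_lt with rfl | hkl
      · rfl
      · exact List.pairwise_iff_getElem.1 (List.pairwise_map.1 hP.2) _ _ (by omega) (by omega)
          (by omega)
    · intro k hk hkN
      rw [pathMag_eq hk (hkN.trans hNP)]
      refine hAbig _ (ht.subset ?_)
      rw [List.mem_take_iff_getElem]
      exact ⟨k - 1, by omega, rfl⟩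
    · intro k hk hkn
      rw [pathMag_eq (by omega) hkn]
      refine hB _ (hd.subset ?_)
      rw [List.mem_drop_iff_getElem]
      exact ⟨k - 1 - N, by omega, by congr 1; omega⟩
  refine ⟨hN, fun i hi1 hi2 => ?_⟩
  have hsorted : (A.map Candidate.split).Pairwise (· ≤ ·) := by
    rw [List.pairwise_iff_getElem]
    intro k l hk hl hkl
    rw [List.length_map] at hk hl
    rw [List.getElem_map, List.getElem_map]
    exact H.le_of_near (by omega : k + 1 < l + 1) (by omega) (hget k hk).1 (hget l hl).1
  -- Well-separated change-points already put the splits of `A` in order, and a sorted rearrangement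
  -- is unique.
  have hins : ((P.take N).map Candidate.split).insertionSort (· ≤ ·) = A.map Candidate.split :=
    List.Perm.eq_of_pairwise (fun _ _ _ _ h1 h2 => le_antisymm h1 h2)
      (List.pairwise_insertionSort _ _) hsorted
      ((List.perm_insertionSort _ _).trans (ht.map _))
  have hloc : sdllLoc X P ζ β i = (A[i - 1]'(by omega)).split := by
    unfold sdllLoc
    rw [hN, hins, List.getD_eq_getElem _ _ (by rw [List.length_map]; omega), List.getElem_map]
  rw [hloc]
  have := (hget (i - 1) (by omega)).1
  rw [Nat.sub_add_cancel hi1] at this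
  rcases this with ⟨rfl, -⟩ | ⟨rfl, -⟩ | ⟨-, -, h3⟩
  · omega
  · omega
  · exact h3

/-! ### Probability that the random intervals miss. -/

theorem two_mul_card_subintervals_le (s e : ℕ) :
    2 * (subintervals s e).card ≤ (e + 1 - s) ^ 2 := by
  classical
  have h1 : ((subintervals s e).image Prod.swap).card = (subintervals s e).card :=
    Finset.card_image_of_injective _ Prod.swap_injective
  have h2 : Disjoint (subintervals s e) ((subintervals s e).image Prod.swap) := by
    rw [Finset.disjoint_left]
    rintro p hp hq
    obtain ⟨q, hq', rfl⟩ := Finset.mem_image.1 hq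
    rw [mem_subintervals] at hp hq'
    simp only [Prod.fst_swap, Prod.snd_swap] at hp
    omega
  have h3 : subintervals s e ∪ (subintervals s e).image Prod.swap
      ⊆ Finset.Icc s e ×ˢ Finset.Icc s e := by
    intro p hp
    rw [Finset.mem_product, Finset.mem_Icc, Finset.mem_Icc]
    rcases Finset.mem_union.1 hp with hp | hp
    · rw [mem_subintervals] at hp
      omega
    · obtain ⟨q, hq, rfl⟩ := Finset.mem_image.1 hp
      rw [mem_subintervals] at hq
      simp only [Prod.fst_swap, Prod.snd_swap]
      omega
  have h4 := Finset.card_le_card h3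
  rw [Finset.card_union_of_disjoint h2, h1, Finset.card_product, Nat.card_Icc] at h4
  linarith

theorem card_le_of_abs_sub_le {S : Finset ℕ} {a R : ℝ} (hR : 0 ≤ R)
    (h : ∀ x ∈ S, |a - x| ≤ R) : (S.card : ℝ) ≤ 2 * R + 1 := by
  rcases S.eq_empty_or_nonempty with rfl | hS
  · simp
    linarith
  have h1 : S ⊆ Finset.Icc (S.min' hS) (S.max' hS) := fun x hx =>
    Finset.mem_Icc.2 ⟨S.min'_le x hx, S.le_max' x hx⟩
  have h2 := Finset.card_le_card h1
  rw [Nat.card_Icc] at h2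
  have h3 := abs_le.1 (h _ (S.min'_mem hS))
  have h4 := abs_le.1 (h _ (S.max'_mem hS))
  have h5 : S.min' hS ≤ S.max' hS := S.min'_le _ (S.max'_mem hS)
  have h6 : (S.card : ℝ) + S.min' hS ≤ S.max' hS + 1 := by
    exact_mod_cast (by omega : S.card + S.min' hS ≤ S.max' hS + 1)
  linarith

section Probability

variable {Ω : Type*} [MeasurableSpace Ω] {μ : Measure Ω} [IsProbabilityMeasure μ]

/-- `M` independent uniform draws all miss a set `F` of intervals with probability at most
`(1 - q) ^ M`, where `q` is a lower bound for the proportion of `F`. -/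
theorem IsIntervalDraw.measureReal_forall_notMem_le {T M : ℕ} {D : ℕ → ℕ → ℕ → Ω → ℕ × ℕ}
    (hD : IsIntervalDraw μ T M D) {s e : ℕ} (hs : 1 ≤ s) (hse : s < e) (he : e ≤ T)
    {F : Finset (ℕ × ℕ)} (hF : F ⊆ subintervals s e) {q : ℝ}
    (hq : q ≤ F.card / (subintervals s e).card) :
    μ.real {ω | ∀ m < M, D s e m ω ∉ F} ≤ (1 - q) ^ M := by
  have hind : iIndepFun (fun m => D s e m) μ :=
    hD.indep.precomp (g := fun m : ℕ => (s, e, m)) fun m m' h => by simpa using h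
  have hset : {ω | ∀ m < M, D s e m ω ∉ F}
      = ⋂ m ∈ Finset.range M, D s e m ⁻¹' ((F : Set (ℕ × ℕ))ᶜ) := by
    ext ω
    simp
  have hmeas : MeasurableSet ((F : Set (ℕ × ℕ))) := F.measurableSet
  rw [hset, measureReal_def, hind.measure_inter_preimage_eq_mul _ (fun _ _ => hmeas.compl),
    ENNReal.toReal_prod]
  refine (Finset.prod_le_prod (g := fun _ => 1 - q) (fun _ _ => ENNReal.toReal_nonneg)
    fun m hm => ?_).trans_eq (by rw [Finset.prod_const, Finset.card_range])
  have hm' := Finset.mem_range.1 hm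
  rw [← measureReal_def, Set.preimage_compl, probReal_compl_eq_one_sub (hD.measurable s e m hmeas)]
  have h1 : μ.real (D s e m ⁻¹' (F : Set (ℕ × ℕ))) = F.card / (subintervals s e).card := by
    rw [← sum_measureReal_preimage_singleton F fun p _ =>
      hD.measurable s e m (measurableSet_singleton p)]
    refine (Finset.sum_congr rfl fun p hp => hD.uniform s e m hs hse he hm' p (hF hp)).trans ?_
    rw [Finset.sum_const, nsmul_eq_mul]
    ring
  rw [h1]
  linarith

/-- There are h² ≥ δ²T²/16 favourable intervals among at most T²/2, a proportion of at least δ²/8.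
-/
theorem Regime.measureReal_not_favourable_le {f ε : ℕ → ℝ} {T N : ℕ} {η : ℕ → ℕ}
    {δ W lam fmin : ℝ} (H : Regime f ε T N η δ W lam fmin) {M h : ℕ} (hh : h = ⌈δ * T / 4⌉₊)
    {D : ℕ → ℕ → ℕ → Ω → ℕ × ℕ} (hD : IsIntervalDraw μ T M D) {i j k x e : ℕ}
    (hik : i < k) (hkj : k < j) (hj : j ≤ N + 1) (heT : e ≤ T)
    (hx : |(η i : ℝ) - x| ≤ δ ^ 3 * T / 2048) (he : |(η j : ℝ) - e| ≤ δ ^ 3 * T / 2048) :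
    μ.real {ω | ∀ p ∈ examined (fun s e m => D s e m ω) M (x + 1) e, ¬ Favourable η h k p}
      ≤ (1 - δ ^ 2 / 9) ^ M := by
  have hc := H.cube_le
  have hL := H.length_ge
  have hδ := H.δ_pos
  have hδ1 := H.δ_le_one
  have hT := H.length_pos
  have hh1 : (h : ℝ) < δ * T / 4 + 1 := by
    rw [hh]
    exact Nat.ceil_lt_add_one (by linarith)
  have hh2 : δ * T / 4 ≤ (h : ℝ) := by
    rw [hh]
    exact Nat.le_ceil _
  have hh0 : 1 ≤ h := by
    have : (0 : ℝ) < h := by linarith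
    exact_mod_cast this
  have hx' := abs_le.1 hx
  have he' := abs_le.1 he
  have sp : ∀ a b, a < b → b ≤ N + 1 → δ * T ≤ (η b : ℝ) - η a := by
    intro a b hab hb
    have h1 := H.spacing a (by omega)
    have h2 : (η (a + 1) : ℝ) ≤ η b := by exact_mod_cast H.eta_mono hab hb
    linarith
  have s1 := sp i k hik (by omega)
  have s2 := sp k j hkj hj
  have b1 : x + 2 * h ≤ η k := by
    have : (x : ℝ) + 2 * h ≤ η k := by linarith
    exact_mod_cast this
  have b2 : η k + 2 * h ≤ e + 1 := by
    have : (η k : ℝ) + 2 * h ≤ e + 1 := by linarith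
    exact_mod_cast this
  have hq0 : 0 ≤ 1 - δ ^ 2 / 9 := by
    have : δ ^ 2 ≤ 1 := pow_le_one₀ hδ.le hδ1
    linarith
  -- If all subintervals are examined, the symmetric interval around η k is among them and the event
  -- is empty.
  by_cases hall : (e - (x + 1) + 1) * (e - (x + 1)) ≤ 2 * M
  · have : {ω | ∀ p ∈ examined (fun s e m => D s e m ω) M (x + 1) e, ¬ Favourable η h k p} = ∅ := by
      rw [Set.eq_empty_iff_forall_notMem]
      intro ω hω
      refine hω (η k - h, η k + h) ?_ ⟨?_, ?_, ?_, ?_⟩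
      · rw [examined, if_pos hall, mem_subintervals]
        dsimp only
        omega
      all_goals dsimp only; omega
    rw [this, measureReal_empty]
    exact pow_nonneg hq0 M
  · let F : Finset (ℕ × ℕ) :=
      Finset.Ico (η k - 2 * h + 1) (η k - h + 1) ×ˢ Finset.Ico (η k + h) (η k + 2 * h)
    have hFmem : ∀ p ∈ F, p ∈ subintervals (x + 1) e ∧ Favourable η h k p := by
      intro p hp
      simp only [F, Finset.mem_product, Finset.mem_Ico] at hp
      rw [mem_subintervals, Favourable]
      omega
    have hFcard : (F.card : ℝ) = (h : ℝ) ^ 2 := by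
      simp only [F, Finset.card_product, Nat.card_Ico]
      rw [show η k - h + 1 - (η k - 2 * h + 1) = h by omega,
        show η k + 2 * h - (η k + h) = h by omega]
      push_cast
      ring
    have hq : δ ^ 2 / 9 ≤ (F.card : ℝ) / (subintervals (x + 1) e).card := by
      have c1 : F.card ≤ (subintervals (x + 1) e).card :=
        Finset.card_le_card fun p hp => (hFmem p hp).1
      have c1' : (F.card : ℝ) ≤ (subintervals (x + 1) e).card := by exact_mod_cast c1
      have c2 : 2 * ((subintervals (x + 1) e).card : ℝ) ≤ (T : ℝ) ^ 2 := by
        have := two_mul_card_subintervals_le (x + 1) e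
        have h2 : (e + 1 - (x + 1)) ^ 2 ≤ T ^ 2 := Nat.pow_le_pow_left (by omega) 2
        exact_mod_cast this.trans h2
      have hh3 : (δ * T / 4) ^ 2 ≤ (h : ℝ) ^ 2 := pow_le_pow_left₀ (by positivity) hh2 2
      have hpos : (0 : ℝ) < (h : ℝ) ^ 2 := by positivity
      rw [hFcard] at c1' ⊢
      rw [le_div_iff₀ (by linarith)]
      have t := mul_le_mul_of_nonneg_left c2 (by positivity : 0 ≤ δ ^ 2 / 18)
      have t2 : 0 ≤ δ ^ 2 * (T : ℝ) ^ 2 := by positivity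
      linarith
    refine le_trans (measureReal_mono ?_) (hD.measureReal_forall_notMem_le (by omega : 1 ≤ x + 1)
      (by omega : x + 1 < e) heT (fun p hp => (hFmem p hp).1) hq)
    intro ω hω m hm hmem
    refine hω _ ?_ (hFmem _ hmem).2
    rw [examined, if_neg hall, Finset.mem_inter]
    exact ⟨Finset.mem_image.2 ⟨m, Finset.mem_range.2 hm, rfl⟩, (hFmem _ hmem).1⟩

theorem sum_range_sum_Icc_const (N : ℕ) (c : ℝ) :
    ∑ i ∈ Finset.range N, ∑ _j ∈ Finset.Icc (i + 2) (N + 1), c = 1 / 2 * N * (N + 1) * c := by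
  have h : ∀ i ∈ Finset.range N, ∑ _j ∈ Finset.Icc (i + 2) (N + 1), c = ((N : ℝ) - i) * c := by
    intro i hi
    rw [Finset.mem_range] at hi
    rw [Finset.sum_const, Nat.card_Icc, nsmul_eq_mul, show N + 1 + 1 - (i + 2) = N - i by omega,
      Nat.cast_sub hi.le]
  rw [Finset.sum_congr rfl h, ← Finset.sum_mul]
  congr 1
  clear h
  rw [Finset.sum_sub_distrib, Finset.sum_const, Finset.card_range, nsmul_eq_mul,
    ← Nat.cast_sum]
  have := Finset.sum_range_id_mul_two N
  have h2 : ((∑ i ∈ Finset.range N, i : ℕ) : ℝ) * 2 = N * ((N : ℝ) - 1) := by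
    rcases Nat.eq_zero_or_pos N with rfl | hN
    · simp
    · have h3 : ((∑ i ∈ Finset.range N, i : ℕ) : ℝ) * 2 = ((N * (N - 1) : ℕ) : ℝ) := by
        exact_mod_cast this
      rw [h3, Nat.cast_mul, Nat.cast_sub hN, Nat.cast_one]
  linarith

/-- Union bound over the N (N + 1) / 2 pairs of non-adjacent change-points and at most 2 R + 1
positions for each end. `R` has to be at least 1 because η 0 and η (N + 1) are off by one from the
ends 0 and T. -/
theorem Regime.measureReal_not_covered_le {f ε : ℕ → ℝ} {T N : ℕ} {η : ℕ → ℕ}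
    {δ W lam fmin R : ℝ} (H : Regime f ε T N η δ W lam fmin) {M h : ℕ} (hh : h = ⌈δ * T / 4⌉₊)
    {D : ℕ → ℕ → ℕ → Ω → ℕ × ℕ} (hD : IsIntervalDraw μ T M D)
    (hR : R * fmin ^ 2 = W) (hR1 : 1 ≤ N → 1 ≤ R) :
    μ.real {ω | ¬ Covered f η T N W h (fun s e m => D s e m ω) M}
      ≤ 1 / 2 * N * (N + 1) * ((2 * R + 1) ^ 2 * (1 - δ ^ 2 / 9) ^ M) := by
  have hf2 : 0 < fmin ^ 2 := pow_pos H.fmin_pos 2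
  have hRle : R ≤ δ ^ 3 * T / 2048 := by
    have := H.W_le
    rw [← hR] at this
    exact le_of_mul_le_mul_right this hf2
  have hR0 : 0 ≤ R := nonneg_of_mul_nonneg_left (hR ▸ H.W_nonneg) hf2
  have hNear : 1 ≤ N → ∀ i x, Near f η T N W i x → |(η i : ℝ) - x| ≤ R := by
    rintro hN i x (⟨rfl, rfl⟩ | ⟨rfl, rfl⟩ | ⟨h1, h2, h3⟩)
    · rw [H.cp.zero]
      simpa using hR1 hN
    · rw [H.cp.last]
      push_cast
      rw [add_sub_cancel_left, abs_one]
      exact hR1 hN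
    · have h4 : fmin ^ 2 ≤ jump f η i ^ 2 :=
        pow_le_pow_left₀ H.fmin_pos.le (H.jump_ge i h1 h2) 2
      have h5 := mul_le_mul_of_nonneg_left h4 (abs_nonneg ((η i : ℝ) - x))
      rw [← hR] at h3
      exact le_of_mul_le_mul_right (h5.trans h3) hf2
  -- One largest jump is fixed for each pair, so `k` adds no factor to the union bound.
  have hk : ∀ i j, ∃ k, i + 2 ≤ j →
      i < k ∧ k < j ∧ ∀ r, i < r → r < j → jump f η r ≤ jump f η k := by
    intro i j
    by_cases hij : i + 2 ≤ j
    · obtain ⟨k, hk, hmax⟩ := (Finset.Ioo i j).exists_max_image (jump f η)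
        ⟨i + 1, Finset.mem_Ioo.2 ⟨by omega, by omega⟩⟩
      rw [Finset.mem_Ioo] at hk
      exact ⟨k, fun _ => ⟨hk.1, hk.2, fun r h1 h2 => hmax r (Finset.mem_Ioo.2 ⟨h1, h2⟩)⟩⟩
    · exact ⟨0, fun h => absurd h hij⟩
  choose k hk using hk
  classical
  let S : ℕ → Finset ℕ := fun i => (Finset.range (T + 1)).filter fun x => |(η i : ℝ) - x| ≤ R
  have hS : ∀ i, ((S i).card : ℝ) ≤ 2 * R + 1 := fun i =>
    card_le_of_abs_sub_le hR0 fun x hx => (Finset.mem_filter.1 hx).2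
  have hsub : {ω | ¬ Covered f η T N W h (fun s e m => D s e m ω) M} ⊆
      ⋃ i ∈ Finset.range N, ⋃ j ∈ Finset.Icc (i + 2) (N + 1), ⋃ x ∈ S i, ⋃ e ∈ S j,
        {ω | ∀ p ∈ examined (fun s e m => D s e m ω) M (x + 1) e,
          ¬ Favourable η h (k i j) p} := by
    intro ω hω
    simp only [Covered, Set.mem_ofPred_eq] at hω
    push Not at hω
    obtain ⟨i, j, x, e, h1, h2, h3, h4, h5, h6⟩ := hω
    obtain ⟨k1, k2, k3⟩ := hk i j h1
    have hn := h6 (k i j) k1 k2 k3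
    have hN : 1 ≤ N := by omega
    have hxn := hNear hN i x h4
    have hxT : x ≤ T := by
      have a1 := abs_le.1 hxn
      have a2 := H.spacing i (by omega)
      have a3 : (η (i + 1) : ℝ) ≤ T + 1 := by exact_mod_cast H.eta_le (i := i + 1) (by omega)
      have a4 := H.cube_le
      have a5 := H.length_ge
      have : (x : ℝ) ≤ T := by linarith
      exact_mod_cast this
    simp only [Set.mem_iUnion]
    exact ⟨i, Finset.mem_range.2 (by omega), j, Finset.mem_Icc.2 ⟨h1, h2⟩, x,
      Finset.mem_filter.2 ⟨Finset.mem_range.2 (by omega), hxn⟩, e,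
      Finset.mem_filter.2 ⟨Finset.mem_range.2 (by omega), hNear hN j e h5⟩, hn⟩
  have hq0 : 0 ≤ (1 - δ ^ 2 / 9) ^ M := by
    have : δ ^ 2 ≤ 1 := pow_le_one₀ H.δ_pos.le H.δ_le_one
    exact pow_nonneg (by linarith) M
  refine (measureReal_mono hsub (measure_ne_top _ _)).trans ?_
  rw [← sum_range_sum_Icc_const]
  refine (measureReal_biUnion_finset_le _ _).trans (Finset.sum_le_sum fun i hi => ?_)
  refine (measureReal_biUnion_finset_le _ _).trans (Finset.sum_le_sum fun j hj => ?_)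
  rw [Finset.mem_Icc] at hj
  calc _ ≤ ∑ x ∈ S i, ∑ e ∈ S j, (1 - δ ^ 2 / 9) ^ M := by
        refine (measureReal_biUnion_finset_le _ _).trans (Finset.sum_le_sum fun x hx => ?_)
        refine (measureReal_biUnion_finset_le _ _).trans (Finset.sum_le_sum fun e he => ?_)
        obtain ⟨k1, k2, -⟩ := hk i j hj.1
        have hx' := (Finset.mem_filter.1 hx).2
        have he' := Finset.mem_filter.1 he
        exact H.measureReal_not_favourable_le hh hD k1 k2 hj.2
          (by have := Finset.mem_range.1 he'.1; omega) (hx'.trans hRle) (he'.2.trans hRle)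
    _ = (S i).card * (S j).card * (1 - δ ^ 2 / 9) ^ M := by
        simp only [Finset.sum_const, nsmul_eq_mul]
        ring
    _ ≤ (2 * R + 1) ^ 2 * (1 - δ ^ 2 / 9) ^ M := by
        refine mul_le_mul_of_nonneg_right ?_ hq0
        rw [sq]
        exact mul_le_mul (hS i) (hS j) (Nat.cast_nonneg _) (by linarith)

end Probability

/-! ### Asymptotics and choice of constants. -/

/-- Squared, the right side is at least C² T ^ (2κ + 1), a positive power of T, which beats log T.
-/
theorem eventually_mul_sqrt_log_le {C κ : ℝ} (hC : 0 < C) (hκ : -1 / 2 < κ) (s : ℝ) :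
    ∀ᶠ T : ℕ in Filter.atTop, ∀ x : ℝ, C * (T : ℝ) ^ κ ≤ x →
      s * √(Real.log T) ≤ x * √T := by
  have hlo := (isLittleO_log_rpow_atTop (by linarith : 0 < κ + κ + 1)).bound
    (by positivity : 0 < C ^ 2 / (s ^ 2 + 1))
  filter_upwards [tendsto_natCast_atTop_atTop.eventually hlo, Filter.eventually_ge_atTop 1]
    with T hT hT1 x hx
  have hT0 : (0 : ℝ) < T := by exact_mod_cast hT1
  have hlog : 0 ≤ Real.log T := Real.log_nonneg (by exact_mod_cast hT1)
  rw [Real.norm_of_nonneg hlog, Real.norm_of_nonneg (by positivity), div_mul_eq_mul_div,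
    le_div_iff₀ (by positivity), Real.rpow_add hT0, Real.rpow_add hT0, Real.rpow_one] at hT
  have hx0 : 0 ≤ C * (T : ℝ) ^ κ := by positivity
  have hsq := pow_le_pow_left₀ hx0 hx 2
  have hx' : 0 ≤ x := hx0.trans hx
  apply le_of_sq_le_sq _ (by positivity)
  rw [mul_pow, mul_pow, Real.sq_sqrt hlog, Real.sq_sqrt hT0.le]
  have := mul_le_mul_of_nonneg_right hsq hT0.le
  nlinarith

theorem SignalConditions.jump_le {δ fbar C κ fmin : ℝ} {f : ℕ → ℝ} {T N : ℕ} {η : ℕ → ℕ}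
    (h : SignalConditions δ fbar C κ f T N η fmin) {i : ℕ} (h1 : 1 ≤ i) (h2 : i ≤ N) :
    jump f η i ≤ 2 * fbar := by
  have mono : ∀ a b, a ≤ b → b ≤ N + 1 → η a ≤ η b := by
    intro a b hab hb
    induction b, hab using Nat.le_induction with
    | base => rfl
    | succ b hab ih => exact (ih (by omega)).trans (h.changePoints.lt b (by omega)).le
  have a1 := h.changePoints.lt (i - 1) (by omega)
  rw [Nat.sub_add_cancel h1] at a1
  have a2 := mono 0 (i - 1) (by omega) (by omega)
  rw [h.changePoints.zero] at a2
  have a3 := h.changePoints.lt i h2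
  have a4 := mono (i + 1) (N + 1) (by omega) le_rfl
  rw [h.changePoints.last] at a4
  have b1 := h.bounded (η i) (by omega) (by omega)
  have b2 := h.bounded (η i - 1) (by omega) (by omega)
  have := abs_sub (f (η i)) (f (η i - 1))
  rw [jump]
  linarith

theorem SignalConditions.regime {δ fbar C κ fmin : ℝ} {f ε : ℕ → ℝ} {T N : ℕ} {η : ℕ → ℕ}
    {W lam : ℝ} (h : SignalConditions δ fbar C κ f T N η fmin) (hδ : 0 < δ) (hC : 0 < C)
    (hε : SumBound ε 1 T lam) (hlam : 0 ≤ lam) (hW : 256 * 512 ^ 2 * lam ^ 2 ≤ W * δ ^ 7)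
    (hWT : W ≤ δ ^ 3 * T / 2048 * fmin ^ 2) (hT : 2048 ≤ δ ^ 3 * T)
    (hsig : 2 * (lam + √(3 * W)) ≤ fmin * √(δ * T / 32) / 2)
    (hfbar : 2 * (2 * fbar) ^ 2 ≤ W) : Regime f ε T N η δ W lam fmin where
  cp := h.changePoints
  δ_pos := hδ
  spacing i hi := by simpa using h.spacing (i + 1) (by omega) (by omega)
  jump_ge := h.jump_ge
  fmin_pos := by
    refine lt_of_lt_of_le ?_ h.fmin_ge
    have : (0 : ℝ) < T := by
      by_contra h0
      have := mul_nonneg (pow_pos hδ 3).le (neg_nonneg.2 (not_lt.1 h0))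
      linarith
    positivity
  noise := hε
  lam_nonneg := hlam
  W_ge := hW
  W_le := hWT
  length_ge := hT
  signal_ge := hsig
  jump_le i h1 h2 := by
    have := pow_le_pow_left₀ (abs_nonneg _) (h.jump_le h1 h2) 2
    exact (mul_le_mul_of_nonneg_left this (by norm_num)).trans hfbar

theorem sumBound_of_mem_noiseEvent {Ω : Type*} {σ Δ : ℝ} {T : ℕ} {ε : ℕ → Ω → ℝ} {ω : Ω}
    (h : ω ∈ noiseEvent σ Δ T ε) :
    SumBound (fun t => ε t ω) 1 T (σ * √(2 * (1 + Δ) * Real.log T)) := by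
  intro l m h1 h2 h3
  have := h l m h1 h2 h3
  have hpos : (0 : ℝ) < (m : ℝ) - l + 1 := by
    have : (l : ℝ) ≤ m := by exact_mod_cast h2
    linarith
  rwa [div_le_iff₀ (Real.sqrt_pos.2 hpos)] at this

end WBS2

theorem theorem2 {σ δ Δ : ℝ} (hσ : 0 < σ) (hδ : 0 < δ) (hΔ : 0 < Δ) :
    ∃ C₁ : ℝ, 0 < C₁ ∧ ∀ θ : ℝ, 0 < θ →
    ∃ Ct₀ : ℝ, ∀ Ct : ℝ, Ct₀ ≤ Ct →
    ∀ β fbar C κ : ℝ, 0 < β → β < 1 → 0 < C → -1 / 2 < κ →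
    ∃ T₀ : ℕ, ∀ T : ℕ, T₀ ≤ T →
    ∀ (N : ℕ) (f : ℕ → ℝ) (η : ℕ → ℕ) (fmin : ℝ),
      WBS2.SignalConditions δ fbar C κ f T N η fmin →
    ∀ M : ℕ, 1 ≤ M →
    ∀ {Ω : Type*} [MeasurableSpace Ω] (μ : Measure Ω) [IsProbabilityMeasure μ]
      (ε : ℕ → Ω → ℝ) (D : ℕ → ℕ → ℕ → Ω → ℕ × ℕ) (X : Ω → ℕ → ℝ)
      (P : Ω → List WBS2.Candidate) (σhat : Ω → ℝ),
      WBS2.IsGaussianNoise μ σ T ε →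
      WBS2.IsIntervalDraw μ T M D →
      IndepFun (fun ω t => ε t ω) (fun ω (i : ℕ × ℕ × ℕ) => D i.1 i.2.1 i.2.2 ω) μ →
      (∀ ω t, X ω t = f t + ε t ω) →
      (∀ ω, WBS2.IsSorted (X ω)
        (WBS2.solPath (X ω) (fun s e m => D s e m ω) M 1 T) (P ω)) →
      (∀ l, MeasurableSet {ω | P ω = l}) →
      Measurable σhat →
      1 - WBS2.alpha μ σ Δ T ε
          - (1 / 2) * N * (N + 1) * (2 * C₁ * (fmin ^ 2)⁻¹ * Real.log T + 1) ^ 2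
            * (1 - δ ^ 2 / 9) ^ M
          - μ.real {ω | ¬ ((1 + θ)⁻¹ < σhat ω / σ ∧ σhat ω / σ < 1 + θ)}
        ≤ μ.real {ω |
            WBS2.sdllN (X ω) (P ω) (Ct * σhat ω * √(2 * Real.log T)) β = N ∧
            ∀ i, 1 ≤ i → i ≤ N →
              |(η i : ℝ) -
                WBS2.sdllLoc (X ω) (P ω) (Ct * σhat ω * √(2 * Real.log T)) β i|
              ≤ C₁ * (fmin ^ 2)⁻¹ * Real.log T} := by
  -- Chosen so that `Regime.W_ge` holds with equality for W = C₁ log T.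
  obtain ⟨C₁, hC₁⟩ : ∃ C₁ : ℝ, C₁ = 256 * 512 ^ 2 * (σ ^ 2 * (2 * (1 + Δ))) / δ ^ 7 := ⟨_, rfl⟩
  have hC₁0 : 0 < C₁ := by
    rw [hC₁]
    positivity
  refine ⟨C₁, hC₁0, fun θ hθ => ?_⟩
  obtain ⟨c₂, hc₂⟩ : ∃ c₂ : ℝ, c₂ = 2 * (σ * √(2 * (1 + Δ)) + √(3 * C₁)) := ⟨_, rfl⟩
  have hc₂0 : 0 < c₂ := by
    rw [hc₂]
    positivity
  -- The noise-level CUSUMs are at most c₂ √(log T); this makes the threshold exceed that for every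
  -- estimate above σ / (1 + θ).
  refine ⟨(c₂ + 1) * (1 + θ) / (σ * √2), fun Ct hCt β fbar C κ hβ0 hβ1 hC hκ => ?_⟩
  have hCt0 : 0 < Ct := lt_of_lt_of_le (by positivity) hCt
  have hδs : 0 < √(δ / 32) := by positivity
  -- The first three conditions give, in turn, `W_le`, `signal_ge`, and a threshold below β times
  -- the large CUSUMs.
  have ev : ∀ᶠ T : ℕ in Filter.atTop,
      (∀ x : ℝ, C * (T : ℝ) ^ κ ≤ x → √(2048 * C₁ / δ ^ 3) * √(Real.log T) ≤ x * √T) ∧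
      (∀ x : ℝ, C * (T : ℝ) ^ κ ≤ x → 2 * c₂ / √(δ / 32) * √(Real.log T) ≤ x * √T) ∧
      (∀ x : ℝ, C * (T : ℝ) ^ κ ≤ x →
        Ct * (σ * (1 + θ)) * √2 / (β * √(δ / 32)) * √(Real.log T) ≤ x * √T) ∧
      2 * (2 * fbar) ^ 2 / C₁ ≤ Real.log T ∧ 1 ≤ Real.log T ∧ 2048 / δ ^ 3 ≤ (T : ℝ) := by
    refine (WBS2.eventually_mul_sqrt_log_le hC hκ _).and <|
      (WBS2.eventually_mul_sqrt_log_le hC hκ _).and <|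
      (WBS2.eventually_mul_sqrt_log_le hC hκ _).and <| Filter.Eventually.and ?_ <|
      Filter.Eventually.and ?_ ?_
    · exact (Real.tendsto_log_atTop.comp tendsto_natCast_atTop_atTop).eventually_ge_atTop _
    · exact (Real.tendsto_log_atTop.comp tendsto_natCast_atTop_atTop).eventually_ge_atTop _
    · exact tendsto_natCast_atTop_atTop.eventually_ge_atTop _
  obtain ⟨T₀, hT₀⟩ := Filter.eventually_atTop.1 ev
  refine ⟨T₀, fun T hT N f η fmin hf M _ Ω _ μ _ ε D X P σhat _ hD _ hX hP _ _ => ?_⟩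
  obtain ⟨e1, e2, e3, e4, e5, e6⟩ := hT₀ T hT
  replace e1 := e1 fmin hf.fmin_ge
  replace e2 := e2 fmin hf.fmin_ge
  replace e3 := e3 fmin hf.fmin_ge
  have hlog : 0 < Real.log T := by linarith
  have hT0 : (0 : ℝ) < T := lt_of_lt_of_le (by positivity) e6
  have hfmin : 0 < fmin := lt_of_lt_of_le (by positivity) hf.fmin_ge
  obtain ⟨lam, hlam⟩ : ∃ lam : ℝ, lam = σ * √(2 * (1 + Δ) * Real.log T) := ⟨_, rfl⟩
  obtain ⟨W, hW⟩ : ∃ W : ℝ, W = C₁ * Real.log T := ⟨_, rfl⟩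
  have hlam0 : 0 ≤ lam := by
    rw [hlam]
    positivity
  have hscale : √(δ * T / 32) = √(δ / 32) * √T := by
    rw [← Real.sqrt_mul (by positivity)]
    congr 1
    ring
  have hnoise : 2 * (lam + √(3 * W)) = c₂ * √(Real.log T) := by
    rw [hlam, hW, hc₂, Real.sqrt_mul (by positivity) (Real.log T), ← mul_assoc 3,
      Real.sqrt_mul (by positivity) (Real.log T)]
    ring
  have reg : ∀ ε' : ℕ → ℝ, WBS2.SumBound ε' 1 T lam →
      WBS2.Regime f ε' T N η δ W lam fmin := by
    intro ε' hε'
    refine hf.regime hδ hC hε' hlam0 (le_of_eq ?_) ?_ ?_ ?_ ?_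
    · rw [hlam, hW, hC₁, mul_pow, Real.sq_sqrt (by positivity)]
      field_simp
    · have := pow_le_pow_left₀ (by positivity) e1 2
      rw [mul_pow, mul_pow, Real.sq_sqrt (by positivity), Real.sq_sqrt hlog.le,
        Real.sq_sqrt hT0.le, div_mul_eq_mul_div, div_le_iff₀ (by positivity)] at this
      rw [hW]
      linarith
    · rwa [div_le_iff₀ (by positivity), mul_comm] at e6
    · rw [hnoise, hscale]
      rw [div_mul_eq_mul_div, div_le_iff₀ hδs] at e2
      linarith
    · rw [div_le_iff₀ hC₁0] at e4
      linarith
  -- Coverage does not involve the noise, so its probability can be bounded in the regime with zero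
  -- noise.
  have H0 := reg (fun _ => 0) (fun l m _ _ _ => by
    rw [Finset.sum_const_zero, abs_zero]
    positivity)
  have hR : C₁ * (fmin ^ 2)⁻¹ * Real.log T * fmin ^ 2 = W := by
    rw [hW]
    field_simp
  have hcov := H0.measureReal_not_covered_le (M := M) rfl hD hR fun hN => by
    have j1 := H0.jump_le 1 le_rfl hN
    have j2 := pow_le_pow_left₀ hfmin.le (H0.jump_ge 1 le_rfl hN) 2
    rw [← hR] at j1
    have : 1 * fmin ^ 2 ≤ C₁ * (fmin ^ 2)⁻¹ * Real.log T * fmin ^ 2 := by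
      linarith [sq_nonneg fmin]
    exact le_of_mul_le_mul_right this (by positivity)
  have hsub : WBS2.noiseEvent σ Δ T ε ⊆
      ({ω | WBS2.sdllN (X ω) (P ω) (Ct * σhat ω * √(2 * Real.log T)) β = N ∧
          ∀ i, 1 ≤ i → i ≤ N →
            |(η i : ℝ) - WBS2.sdllLoc (X ω) (P ω) (Ct * σhat ω * √(2 * Real.log T)) β i|
              ≤ C₁ * (fmin ^ 2)⁻¹ * Real.log T} ∪
        {ω | ¬ WBS2.Covered f η T N W ⌈δ * T / 4⌉₊ (fun s e m => D s e m ω) M}) ∪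
        {ω | ¬ ((1 + θ)⁻¹ < σhat ω / σ ∧ σhat ω / σ < 1 + θ)} := by
    intro ω hω
    by_cases h1 : (1 + θ)⁻¹ < σhat ω / σ ∧ σhat ω / σ < 1 + θ
    swap
    · exact Or.inr h1
    by_cases h2 : WBS2.Covered f η T N W ⌈δ * T / 4⌉₊ (fun s e m => D s e m ω) M
    swap
    · exact Or.inl (Or.inr h2)
    refine Or.inl (Or.inl ?_)
    have H := reg (fun t => ε t ω) (hlam ▸ WBS2.sumBound_of_mem_noiseEvent hω)
    have l1 : σ / (1 + θ) < σhat ω := by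
      have := (lt_div_iff₀ hσ).1 h1.1
      rwa [inv_mul_eq_div] at this
    have l2 : σhat ω < σ * (1 + θ) := by
      have := (div_lt_iff₀ hσ).1 h1.2
      linarith
    have hs2 : √(2 * Real.log T) = √2 * √(Real.log T) := Real.sqrt_mul (by norm_num) _
    have hζ : 2 * (lam + √(3 * W)) < Ct * σhat ω * √(2 * Real.log T) := by
      rw [hnoise, hs2, ← mul_assoc]
      refine mul_lt_mul_of_pos_right ?_ (Real.sqrt_pos.2 hlog)
      calc c₂ < c₂ + 1 := by linarith
        _ = (c₂ + 1) * (1 + θ) / (σ * √2) * (σ / (1 + θ)) * √2 := by field_simp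
        _ ≤ Ct * σhat ω * √2 := by gcongr
    have hζ2 : Ct * σhat ω * √(2 * Real.log T) ≤ β * (fmin * √(δ * T / 32)) := by
      rw [div_mul_eq_mul_div, div_le_iff₀ (by positivity)] at e3
      rw [hs2, hscale]
      calc Ct * σhat ω * (√2 * √(Real.log T))
          ≤ Ct * (σ * (1 + θ)) * (√2 * √(Real.log T)) := by gcongr
        _ ≤ _ := by linarith
    obtain ⟨r1, r2⟩ := H.sdll_correct (hX ω) rfl h2 (hP ω) hβ0 hβ1 hζ hζ2
    refine ⟨r1, fun i hi1 hi2 => ?_⟩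
    have r3 := r2 i hi1 hi2
    have r4 := pow_le_pow_left₀ hfmin.le (H.jump_ge i hi1 hi2) 2
    rw [← hR] at r3
    exact le_of_mul_le_mul_right ((mul_le_mul_of_nonneg_left r4 (abs_nonneg _)).trans r3)
      (by positivity)
  have hmeas := (measureReal_mono (μ := μ) hsub (measure_ne_top _ _)).trans
    ((measureReal_union_le _ _).trans (add_le_add_left (measureReal_union_le _ _) _))
  rw [WBS2.alpha]
  linarith
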